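/- Let $\mathbb D$ be the open unit disc in $\mathbb C$, and for $z\in\mathbb D$ put $$v_{\log}(z)=(1-|z|)\log\frac{2}{1-|z|},\qquad w_{\log}(z)=\Big[\log\log\frac{4}{1-|z|^2}\Big]^{-1}.$$ For $v\in\{v_{\log},w_{\log}\}$ let $\mathcal B^{v}$ be the space of holomorphic $f:\mathbb D\to\mathbb C$ with $\|f\|_{\mathcal B^v}=|f(0)|+\sup_{z\in\mathbb D}v(z)|f'(z)|<\infty$, and let $\mathcal Z^{v}$ be the space of holomorphic $f:\mathbb D\to\mathbb C$ with $\|f\|_{\mathcal Z^v}=|f(0)|+|f'(0)|+\sup_{z\in\mathbb D}v(z)|f''(z)|<\infty$. For holomorphic $u,f:\mathbb D\to\mathbb C$ put $$I_uf(z)=\int_0^z f'(s)u(s)\,ds,\quad J_uf(z)=\int_0^z f(s)u'(s)\,ds,\quad I'_uf(z)=\int_0^z I_uf(s)\,ds,\quad J'_uf(z)=\int_0^z J_uf(s)\,ds .$$ For holomorphic $\varphi:\mathbb D\to\mathbb D$ let $C_\varphi f=f\circ\varphi$ and $W_{u,\varphi}f=u\cdot(f\circ\varphi)$. The essential norm $\|T\|_e^{X\to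 X}$ of a bounded linear operator $T:X\to X$ is the infimum of $\|T-K\|$ over all compact linear operators $K:X\to X$. Theorem. There is a constant $K>0$ such that for every holomorphic $\varphi:\mathbb D\to\mathbb D$ for which $C_\varphi$ is a bounded operator on $\mathcal Z^{v_{\log}}$ the following holds. The operator $W_{\varphi',\varphi}$ is bounded on $\mathcal B^{v_{\log}}$, $$\|C_\varphi\|_e^{\mathcal Z^{v_{\log}}\to\mathcal Z^{v_{\log}}}=\|W_{\varphi',\varphi}\|_e^{\mathcal B^{v_{\log}}\to\mathcal B^{v_{\log}}},$$ and, with $$M_\varphi=\max\left\{\limsup_{n\to\infty}\frac{(n+2)(n+1)\,\|J'_{\varphi'}(\varphi^n)\|_{\mathcal Z^{v_{\log}}}}{\|z^{n+2}\|_{\mathcal Z^{w_{\log}}}},\ \limsup_{n\to\infty}\frac{(n+1)\,\|I'_{\varphi'}(\varphi^n)\|_{\mathcal Z^{v_{\log}}}}{\|z^{n+1}\|_{\mathcal Z^{v_{\log}}}}\right\},$$ one has $$\frac1K\,\|C_\varphi\|_e^{\mathcal Z^{v_{\log}}\to\mathcal Z^{v_{\log}}}\le M_\varphi\le K\,\|C_\varphi\|_e^{\mathcal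 Z^{v_{\log}}\to\mathcal Z^{v_{\log}}}.$$ -/

import Mathlib

open scoped ENNReal NNReal Complex.UnitDisc

noncomputable section

namespace DiscSpaces

/-! ## Holomorphic functions on the open unit disc -/

/-- Extension by zero of a function on the open unit disc to the whole plane. It is only ever
differentiated at points of the (open) disc, where the value of the extension outside of the
disc plays no role. -/
def zeroExt (f : 𝔻 → ℂ) : ℂ → ℂ := Function.extend Complex.UnitDisc.coe f 0

/-- `f : 𝔻 → ℂ` is holomorphic. -/
def IsHolo (f : 𝔻 → ℂ) : Prop := DifferentiableOn ℂ (zeroExt f) (Metric.ball 0 1)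

/-- The complex derivative of a function on the disc, again a function on the disc. -/
def discDeriv (f : 𝔻 → ℂ) : 𝔻 → ℂ := fun z => deriv (zeroExt f) z

/-- The integral `∫_0^z f(s) ds` along the segment from `0` to `z`. -/
def primitive (f : 𝔻 → ℂ) : 𝔻 → ℂ := fun z => ∫ t in (0 : ℝ)..1, (z : ℂ) * zeroExt f ((t : ℂ) * z)

/-- `I_u f (z) = ∫_0^z f'(s) u(s) ds`. -/
def opI (u f : 𝔻 → ℂ) : 𝔻 → ℂ := primitive (fun s => discDeriv f s * u s)

/-- `J_u f (z) = ∫_0^z f(s) u'(s) ds`. -/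
def opJ (u f : 𝔻 → ℂ) : 𝔻 → ℂ := primitive (fun s => f s * discDeriv u s)

/-- `I'_u f (z) = ∫_0^z I_u f (s) ds`. -/
def opI' (u f : 𝔻 → ℂ) : 𝔻 → ℂ := primitive (opI u f)

/-- `J'_u f (z) = ∫_0^z J_u f (s) ds`. -/
def opJ' (u f : 𝔻 → ℂ) : 𝔻 → ℂ := primitive (opJ u f)

/-- The weighted composition operator `W_{u,φ} f = u · (f ∘ φ)` on functions. -/
def weightedCompOp (u : 𝔻 → ℂ) (φ : 𝔻 → 𝔻) (f : 𝔻 → ℂ) : 𝔻 → ℂ := fun z => u z * f (φ z)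

/-- The composition operator `C_φ f = f ∘ φ` on functions. -/
def compOp (φ : 𝔻 → 𝔻) (f : 𝔻 → ℂ) : 𝔻 → ℂ := fun z => f (φ z)

/-- The function `z ↦ φ(z)^n` on the disc. -/
def symbolPow (φ : 𝔻 → 𝔻) (n : ℕ) : 𝔻 → ℂ := fun z => (φ z : ℂ) ^ n

/-- The monomial `g_n(z) = z^n` on the disc. -/
def idPow (n : ℕ) : 𝔻 → ℂ := fun z => (z : ℂ) ^ n

/-! ## Weights -/

/-- A weight on the disc: a bounded, continuous and positive function. -/
structure Weight where
  toFun : 𝔻 → ℝ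
  pos : ∀ z, 0 < toFun z
  continuous : Continuous toFun
  bounded : ∃ C, ∀ z, toFun z ≤ C

instance : CoeFun Weight (fun _ => 𝔻 → ℝ) := ⟨Weight.toFun⟩

/-- `v_log(z) = (1 - |z|) log (2 / (1 - |z|))`. -/
def vLog : Weight where
  toFun z := (1 - ‖(z : ℂ)‖) * Real.log (2 / (1 - ‖(z : ℂ)‖))
  pos z := by
    have h1 := z.norm_lt_one
    have h0 := norm_nonneg (z : ℂ)
    refine mul_pos (by linarith) (Real.log_pos ?_)
    rw [lt_div_iff₀ (by linarith)]
    linarith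
  continuous := by
    have hc : Continuous fun z : 𝔻 => 1 - ‖(z : ℂ)‖ :=
      continuous_const.sub Complex.UnitDisc.continuous_coe.norm
    have hne : ∀ z : 𝔻, 1 - ‖(z : ℂ)‖ ≠ 0 := fun z => by
      have := z.norm_lt_one
      linarith
    exact hc.mul ((continuous_const.div hc hne).log fun z => div_ne_zero two_ne_zero (hne z))
  bounded := by
    refine ⟨2, fun z => ?_⟩
    have h1 : 0 < 1 - ‖(z : ℂ)‖ := by
      have := z.norm_lt_one
      linarith
    have h2 := Real.log_le_sub_one_of_pos (div_pos two_pos h1)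
    calc (1 - ‖(z : ℂ)‖) * Real.log (2 / (1 - ‖(z : ℂ)‖))
        ≤ (1 - ‖(z : ℂ)‖) * (2 / (1 - ‖(z : ℂ)‖)) := by gcongr; linarith
      _ = 2 := by field_simp

lemma one_lt_log_four : 1 < Real.log 4 := by
  rw [Real.lt_log_iff_exp_lt (by norm_num)]
  exact Real.exp_one_lt_d9.trans (by norm_num)

lemma log_four_le (z : 𝔻) : Real.log 4 ≤ Real.log (4 / (1 - ‖(z : ℂ)‖ ^ 2)) := by
  have h1 := z.sq_norm_lt_one
  have h0 := sq_nonneg ‖(z : ℂ)‖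
  refine Real.log_le_log (by norm_num) ?_
  rw [le_div_iff₀ (by linarith)]
  linarith

lemma loglog_pos : 0 < Real.log (Real.log 4) := Real.log_pos one_lt_log_four

lemma loglog_le (z : 𝔻) :
    Real.log (Real.log 4) ≤ Real.log (Real.log (4 / (1 - ‖(z : ℂ)‖ ^ 2))) :=
  Real.log_le_log (zero_lt_one.trans one_lt_log_four) (log_four_le z)

/-- `w_log(z) = [log log (4 / (1 - |z|^2))]⁻¹`. -/
def wLog : Weight where
  toFun z := (Real.log (Real.log (4 / (1 - ‖(z : ℂ)‖ ^ 2))))⁻¹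
  pos z := inv_pos.2 (loglog_pos.trans_le (loglog_le z))
  continuous := by
    have hc : Continuous fun z : 𝔻 => 1 - ‖(z : ℂ)‖ ^ 2 :=
      continuous_const.sub (Complex.UnitDisc.continuous_coe.norm.pow 2)
    have hne : ∀ z : 𝔻, 1 - ‖(z : ℂ)‖ ^ 2 ≠ 0 := fun z => by
      have := z.sq_norm_lt_one
      linarith
    have h1 : Continuous fun z : 𝔻 => Real.log (4 / (1 - ‖(z : ℂ)‖ ^ 2)) :=
      (continuous_const.div hc hne).log fun z => div_ne_zero four_ne_zero (hne z)
    exact (h1.log fun z =>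
      ((zero_lt_one.trans one_lt_log_four).trans_le (log_four_le z)).ne').inv₀
      fun z => (loglog_pos.trans_le (loglog_le z)).ne'
  bounded := ⟨(Real.log (Real.log 4))⁻¹, fun z => inv_anti₀ loglog_pos (loglog_le z)⟩

/-! ## Norms, with value `∞` for functions outside of the spaces -/

/-- `sup_{z ∈ 𝔻} v(z) |f(z)|`. -/
def growthENorm (v : Weight) (f : 𝔻 → ℂ) : ℝ≥0∞ := ⨆ z : 𝔻, ENNReal.ofReal (v z) * ‖f z‖ₑ

/-- `|f(0)| + sup_{z ∈ 𝔻} v(z) |f'(z)|`. -/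
def blochENorm (v : Weight) (f : 𝔻 → ℂ) : ℝ≥0∞ := ‖f 0‖ₑ + growthENorm v (discDeriv f)

/-- `|f(0)| + |f'(0)| + sup_{z ∈ 𝔻} v(z) |f''(z)|`. -/
def zygmundENorm (v : Weight) (f : 𝔻 → ℂ) : ℝ≥0∞ :=
  ‖f 0‖ₑ + ‖discDeriv f 0‖ₑ + growthENorm v (discDeriv (discDeriv f))

/-! ## Elementary facts, used to build the normed spaces -/

lemma zeroExt_coe (f : 𝔻 → ℂ) (z : 𝔻) : zeroExt f z = f z :=
  Complex.UnitDisc.coe_injective.extend_apply f 0 z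

lemma zeroExt_of_mem (f : 𝔻 → ℂ) {z : ℂ} (hz : z ∈ Metric.ball (0 : ℂ) 1) :
    zeroExt f z = f (Complex.UnitDisc.mk z (mem_ball_zero_iff.1 hz)) :=
  zeroExt_coe f (Complex.UnitDisc.mk z (mem_ball_zero_iff.1 hz))

lemma coe_mem (z : 𝔻) : (z : ℂ) ∈ Metric.ball (0 : ℂ) 1 := mem_ball_zero_iff.2 z.norm_lt_one

lemma zeroExt_add_eqOn (f g : 𝔻 → ℂ) :
    Set.EqOn (zeroExt (f + g)) (zeroExt f + zeroExt g) (Metric.ball 0 1) := fun z hz => by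
  simp [zeroExt_of_mem _ hz]

lemma zeroExt_smul_eqOn (c : ℂ) (f : 𝔻 → ℂ) :
    Set.EqOn (zeroExt (c • f)) (c • zeroExt f) (Metric.ball 0 1) := fun z hz => by
  simp [zeroExt_of_mem _ hz]

lemma zeroExt_discDeriv_eqOn (f : 𝔻 → ℂ) :
    Set.EqOn (zeroExt (discDeriv f)) (deriv (zeroExt f)) (Metric.ball 0 1) := fun z hz => by
  simp [zeroExt_of_mem _ hz, discDeriv]

lemma IsHolo.zero : IsHolo 0 :=
  (differentiableOn_const (0 : ℂ)).congr fun z hz => by simp [zeroExt_of_mem _ hz]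

lemma IsHolo.add {f g : 𝔻 → ℂ} (hf : IsHolo f) (hg : IsHolo g) : IsHolo (f + g) :=
  (DifferentiableOn.add hf hg).congr (zeroExt_add_eqOn f g)

lemma IsHolo.smul (c : ℂ) {f : 𝔻 → ℂ} (hf : IsHolo f) : IsHolo (c • f) :=
  (DifferentiableOn.const_smul hf c).congr (zeroExt_smul_eqOn c f)

lemma IsHolo.discDeriv {f : 𝔻 → ℂ} (hf : IsHolo f) : IsHolo (discDeriv f) :=
  (DifferentiableOn.deriv hf Metric.isOpen_ball).congr (zeroExt_discDeriv_eqOn f)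

lemma IsHolo.differentiableAt {f : 𝔻 → ℂ} (hf : IsHolo f) (z : 𝔻) :
    DifferentiableAt ℂ (zeroExt f) z :=
  DifferentiableOn.differentiableAt hf (Metric.isOpen_ball.mem_nhds (coe_mem z))

lemma discDeriv_add {f g : 𝔻 → ℂ} (hf : IsHolo f) (hg : IsHolo g) :
    discDeriv (f + g) = discDeriv f + discDeriv g := funext fun z => by
  have h := (zeroExt_add_eqOn f g).eventuallyEq_of_mem (Metric.isOpen_ball.mem_nhds (coe_mem z))
  change deriv (zeroExt (f + g)) z = deriv (zeroExt f) z + deriv (zeroExt g) z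
  rw [h.deriv_eq, deriv_add (hf.differentiableAt z) (hg.differentiableAt z)]

lemma discDeriv_smul (c : ℂ) {f : 𝔻 → ℂ} (hf : IsHolo f) : discDeriv (c • f) = c • discDeriv f :=
  funext fun z => by
    have h := (zeroExt_smul_eqOn c f).eventuallyEq_of_mem
      (Metric.isOpen_ball.mem_nhds (coe_mem z))
    change deriv (zeroExt (c • f)) z = c • deriv (zeroExt f) z
    rw [h.deriv_eq, deriv_const_smul c (hf.differentiableAt z)]

lemma discDeriv_zero : discDeriv 0 = 0 := by
  simpa using discDeriv_smul 0 IsHolo.zero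

lemma eq_zero_of_discDeriv {f : 𝔻 → ℂ} (hf : IsHolo f) (h0 : f 0 = 0) (h : discDeriv f = 0) :
    f = 0 := by
  have h' : (Metric.ball (0 : ℂ) 1).EqOn (deriv (zeroExt f)) 0 := fun z hz => by
    rw [← zeroExt_discDeriv_eqOn f hz, h]
    simp [zeroExt_of_mem _ hz]
  funext z
  have := Metric.isOpen_ball.is_const_of_deriv_eq_zero
    (convex_ball (0 : ℂ) 1).isPreconnected hf h' (coe_mem z) (coe_mem 0)
  rw [zeroExt_coe, zeroExt_coe, h0] at this
  exact this

lemma growthENorm_add_le (v : Weight) (f g : 𝔻 → ℂ) :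
    growthENorm v (f + g) ≤ growthENorm v f + growthENorm v g := by
  refine iSup_le fun z => ?_
  calc ENNReal.ofReal (v z) * ‖f z + g z‖ₑ
      ≤ ENNReal.ofReal (v z) * (‖f z‖ₑ + ‖g z‖ₑ) := by gcongr; exact enorm_add_le _ _
    _ = ENNReal.ofReal (v z) * ‖f z‖ₑ + ENNReal.ofReal (v z) * ‖g z‖ₑ := mul_add _ _ _
    _ ≤ _ := add_le_add (le_iSup (fun z => ENNReal.ofReal (v z) * ‖f z‖ₑ) z)
      (le_iSup (fun z => ENNReal.ofReal (v z) * ‖g z‖ₑ) z)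

lemma growthENorm_smul (v : Weight) (c : ℂ) (f : 𝔻 → ℂ) :
    growthENorm v (c • f) = ‖c‖ₑ * growthENorm v f := by
  simp only [growthENorm, ENNReal.mul_iSup, Pi.smul_apply, enorm_smul]
  exact iSup_congr fun z => by ring

lemma eq_zero_of_growthENorm (v : Weight) {f : 𝔻 → ℂ} (h : growthENorm v f = 0) : f = 0 := by
  funext z
  have := ENNReal.iSup_eq_zero.1 h z
  rcases mul_eq_zero.1 this with h | h
  · exact absurd (ENNReal.ofReal_eq_zero.1 h) (not_le.2 (v.pos z))
  · simpa using h

lemma growthENorm_zero (v : Weight) : growthENorm v 0 = 0 := by simp [growthENorm]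

lemma blochENorm_add_le (v : Weight) {f g : 𝔻 → ℂ} (hf : IsHolo f) (hg : IsHolo g) :
    blochENorm v (f + g) ≤ blochENorm v f + blochENorm v g := by
  unfold blochENorm
  rw [discDeriv_add hf hg]
  refine (add_le_add (enorm_add_le (f 0) (g 0)) (growthENorm_add_le v _ _)).trans_eq ?_
  ring

lemma blochENorm_smul (v : Weight) (c : ℂ) {f : 𝔻 → ℂ} (hf : IsHolo f) :
    blochENorm v (c • f) = ‖c‖ₑ * blochENorm v f := by
  unfold blochENorm
  rw [discDeriv_smul c hf, growthENorm_smul, Pi.smul_apply, enorm_smul, mul_add]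

lemma zygmundENorm_eq (v : Weight) (f : 𝔻 → ℂ) :
    zygmundENorm v f = ‖f 0‖ₑ + blochENorm v (discDeriv f) := by
  simp [zygmundENorm, blochENorm, add_assoc]

lemma zygmundENorm_add_le (v : Weight) {f g : 𝔻 → ℂ} (hf : IsHolo f) (hg : IsHolo g) :
    zygmundENorm v (f + g) ≤ zygmundENorm v f + zygmundENorm v g := by
  simp only [zygmundENorm_eq]
  rw [discDeriv_add hf hg]
  refine (add_le_add (enorm_add_le (f 0) (g 0))
    (blochENorm_add_le v hf.discDeriv hg.discDeriv)).trans_eq ?_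
  ring

lemma zygmundENorm_smul (v : Weight) (c : ℂ) {f : 𝔻 → ℂ} (hf : IsHolo f) :
    zygmundENorm v (c • f) = ‖c‖ₑ * zygmundENorm v f := by
  simp only [zygmundENorm_eq]
  rw [discDeriv_smul c hf, blochENorm_smul v c hf.discDeriv, Pi.smul_apply, enorm_smul, mul_add]

lemma blochENorm_zero (v : Weight) : blochENorm v 0 = 0 := by
  simp [blochENorm, discDeriv_zero, growthENorm_zero]

lemma zygmundENorm_zero (v : Weight) : zygmundENorm v 0 = 0 := by
  simp [zygmundENorm_eq, discDeriv_zero, blochENorm_zero]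

lemma eq_zero_of_blochENorm (v : Weight) {f : 𝔻 → ℂ} (hf : IsHolo f)
    (h : blochENorm v f = 0) : f = 0 := by
  obtain ⟨h1, h2⟩ := add_eq_zero.1 h
  exact eq_zero_of_discDeriv hf (by simpa using h1) (eq_zero_of_growthENorm v h2)

lemma eq_zero_of_zygmundENorm (v : Weight) {f : 𝔻 → ℂ} (hf : IsHolo f)
    (h : zygmundENorm v f = 0) : f = 0 := by
  rw [zygmundENorm_eq] at h
  obtain ⟨h1, h2⟩ := add_eq_zero.1 h
  exact eq_zero_of_discDeriv hf (by simpa using h1) (eq_zero_of_blochENorm v hf.discDeriv h2)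

/-! ## The Bloch-type space of a weight -/

/-- The holomorphic functions with `sup_{z ∈ 𝔻} v(z) |f'(z)| < ∞`, as a space of functions. -/
def blochSubmodule (v : Weight) : Submodule ℂ (𝔻 → ℂ) where
  carrier := {f | IsHolo f ∧ blochENorm v f < ∞}
  zero_mem' := ⟨IsHolo.zero, by simp [blochENorm_zero]⟩
  add_mem' hf hg := ⟨hf.1.add hg.1,
    (blochENorm_add_le v hf.1 hg.1).trans_lt (ENNReal.add_lt_top.2 ⟨hf.2, hg.2⟩)⟩
  smul_mem' c _ hf := ⟨hf.1.smul c,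
    (blochENorm_smul v c hf.1).trans_lt (ENNReal.mul_lt_top enorm_lt_top hf.2)⟩

/-- The Bloch-type space `B^v`. -/
def Bloch (v : Weight) : Type := blochSubmodule v

instance (v : Weight) : AddCommGroup (Bloch v) := inferInstanceAs (AddCommGroup (blochSubmodule v))

instance (v : Weight) : Module ℂ (Bloch v) := inferInstanceAs (Module ℂ (blochSubmodule v))

/-- The function on the disc that an element of `B^v` is. -/
def Bloch.fn {v : Weight} (f : Bloch v) : 𝔻 → ℂ := f.1

/-- The norm `|f(0)| + sup_{z ∈ 𝔻} v(z) |f'(z)|`. -/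
instance (v : Weight) : Norm (Bloch v) := ⟨fun f => (blochENorm v f.fn).toReal⟩

lemma blochCore (v : Weight) : NormedSpace.Core ℂ (Bloch v) where
  norm_nonneg _ := ENNReal.toReal_nonneg
  norm_smul c f := by
    change (blochENorm v (c • f.1)).toReal = _ * (blochENorm v f.1).toReal
    rw [blochENorm_smul v c f.2.1, ENNReal.toReal_mul, toReal_enorm]
  norm_triangle f g := by
    change (blochENorm v (f.1 + g.1)).toReal ≤
      (blochENorm v f.1).toReal + (blochENorm v g.1).toReal
    rw [← ENNReal.toReal_add f.2.2.ne g.2.2.ne]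
    exact ENNReal.toReal_mono (ENNReal.add_lt_top.2 ⟨f.2.2, g.2.2⟩).ne
      (blochENorm_add_le v f.2.1 g.2.1)
  norm_eq_zero_iff f := by
    change (blochENorm v f.1).toReal = 0 ↔ _
    rw [ENNReal.toReal_eq_zero_iff, or_iff_left f.2.2.ne]
    refine ⟨fun h => Subtype.ext (eq_zero_of_blochENorm v f.2.1 h), ?_⟩
    rintro rfl
    exact blochENorm_zero v

instance (v : Weight) : NormedAddCommGroup (Bloch v) := NormedAddCommGroup.ofCore (blochCore v)

instance (v : Weight) : NormedSpace ℂ (Bloch v) := NormedSpace.ofCore (blochCore v)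

/-! ## The Zygmund-type space of a weight -/

/-- The holomorphic functions with `sup_{z ∈ 𝔻} v(z) |f''(z)| < ∞`, as a space of functions. -/
def zygmundSubmodule (v : Weight) : Submodule ℂ (𝔻 → ℂ) where
  carrier := {f | IsHolo f ∧ zygmundENorm v f < ∞}
  zero_mem' := ⟨IsHolo.zero, by simp [zygmundENorm_zero]⟩
  add_mem' hf hg := ⟨hf.1.add hg.1,
    (zygmundENorm_add_le v hf.1 hg.1).trans_lt (ENNReal.add_lt_top.2 ⟨hf.2, hg.2⟩)⟩
  smul_mem' c _ hf := ⟨hf.1.smul c,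
    (zygmundENorm_smul v c hf.1).trans_lt (ENNReal.mul_lt_top enorm_lt_top hf.2)⟩

/-- The Zygmund-type space `Z^v`. -/
def Zygmund (v : Weight) : Type := zygmundSubmodule v

instance (v : Weight) : AddCommGroup (Zygmund v) :=
  inferInstanceAs (AddCommGroup (zygmundSubmodule v))

instance (v : Weight) : Module ℂ (Zygmund v) := inferInstanceAs (Module ℂ (zygmundSubmodule v))

/-- The function on the disc that an element of `Z^v` is. -/
def Zygmund.fn {v : Weight} (f : Zygmund v) : 𝔻 → ℂ := f.1

/-- The norm `|f(0)| + |f'(0)| + sup_{z ∈ 𝔻} v(z) |f''(z)|`. -/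
instance (v : Weight) : Norm (Zygmund v) := ⟨fun f => (zygmundENorm v f.fn).toReal⟩

lemma zygmundCore (v : Weight) : NormedSpace.Core ℂ (Zygmund v) where
  norm_nonneg _ := ENNReal.toReal_nonneg
  norm_smul c f := by
    change (zygmundENorm v (c • f.1)).toReal = _ * (zygmundENorm v f.1).toReal
    rw [zygmundENorm_smul v c f.2.1, ENNReal.toReal_mul, toReal_enorm]
  norm_triangle f g := by
    change (zygmundENorm v (f.1 + g.1)).toReal ≤
      (zygmundENorm v f.1).toReal + (zygmundENorm v g.1).toReal
    rw [← ENNReal.toReal_add f.2.2.ne g.2.2.ne]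
    exact ENNReal.toReal_mono (ENNReal.add_lt_top.2 ⟨f.2.2, g.2.2⟩).ne
      (zygmundENorm_add_le v f.2.1 g.2.1)
  norm_eq_zero_iff f := by
    change (zygmundENorm v f.1).toReal = 0 ↔ _
    rw [ENNReal.toReal_eq_zero_iff, or_iff_left f.2.2.ne]
    refine ⟨fun h => Subtype.ext (eq_zero_of_zygmundENorm v f.2.1 h), ?_⟩
    rintro rfl
    exact zygmundENorm_zero v

instance (v : Weight) : NormedAddCommGroup (Zygmund v) :=
  NormedAddCommGroup.ofCore (zygmundCore v)

instance (v : Weight) : NormedSpace ℂ (Zygmund v) := NormedSpace.ofCore (zygmundCore v)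

/-! ## The essential norm -/

/-- The essential norm of a bounded operator: its distance to the compact operators,
`inf {‖T - K‖ : K compact}`. -/
def essNorm {X Y : Type*} [NormedAddCommGroup X] [NormedSpace ℂ X] [NormedAddCommGroup Y]
    [NormedSpace ℂ Y] (T : X →L[ℂ] Y) : ℝ :=
  sInf {r : ℝ | ∃ K : X →L[ℂ] Y, IsCompactOperator K ∧ r = ‖T - K‖}

/-- `max {limsup (n+2)(n+1) ‖J'_{φ'}(φ^n)‖_{Z^{v_log}} / ‖z^{n+2}‖_{Z^{w_log}},
limsup (n+1) ‖I'_{φ'}(φ^n)‖_{Z^{v_log}} / ‖z^{n+1}‖_{Z^{v_log}}}`, where `φ'` is the derivative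
of `φ`. -/
def powerQuantity (φ : 𝔻 → 𝔻) : ℝ≥0∞ :=
  max
    (Filter.limsup (fun n : ℕ => ((n : ℝ≥0∞) + 2) * ((n : ℝ≥0∞) + 1) *
      zygmundENorm vLog (opJ' (discDeriv (fun z => (φ z : ℂ))) (symbolPow φ n)) /
        zygmundENorm wLog (idPow (n + 2))) Filter.atTop)
    (Filter.limsup (fun n : ℕ => ((n : ℝ≥0∞) + 1) *
      zygmundENorm vLog (opI' (discDeriv (fun z => (φ z : ℂ))) (symbolPow φ n)) /
        zygmundENorm vLog (idPow (n + 1))) Filter.atTop)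

end DiscSpaces

end

open DiscSpaces

/-!
Differentiation maps the Zygmund-type space onto the Bloch-type space and is inverted, up to
constants, by integration from the origin; both maps are contractions, and they turn `C_φ` into
`S = W_{φ',φ}` up to an operator of rank one. Hence `S` is bounded and the two essential norms agree
(`exists_weightedCompOp_essNorm_eq`).

The rest concerns `S`, with `(S f)' = φ'' f(φ) + φ'^2 f'(φ)`. The essential norm is compared with the
behaviour near the boundary of the two quotients `v |φ''| / w(φ)` and `v |φ'|^2 / v(φ)`, where
`v = v_log` and `w = w_log`.

* The power sequences reduce to `sup v |φ''| |φ|^n / sup w |z|^n` and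
  `sup v |φ'|^2 |φ|^n / sup v |z|^n` (`powerQuantity_eq`). Their upper limits are comparable with the
  quotients near `|φ| = 1`: for `n` about `1 / (2 (1 - |z|))` the function `|s|^n` weighted by `v` or
  `w` is almost largest at `s = z` (`exists_pow_almost_extremal`), and the part where `φ` stays away
  from the boundary is negligible (`limsup_growthENorm_div_le`).
* For the upper bound, `S L` is compact for finite-rank operators `L` close to the identity on
  compact subsets of the disc (`exists_compact_approx`), so only the behaviour near the boundary
  contributes to `S - S L`. There a function in the Bloch-type space grows at most like `1 / w`
  (`norm_le_div_wLog`).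
* For the lower bound, combinations of powers of `log log (4 / (1 - \bar a z))` with `a = φ(z)`
  isolate either of the two terms of `(S f)'`. As `|a|` tends to `1` they tend to zero locally
  uniformly and have derivatives that are small against `1 / v` at the boundary, so a gliding hump
  argument shows that compact operators map them to null sequences (`tendsto_compact_testBloch`). No
  weak topology is needed: sums of `N` suitable test functions have norms bounded independently of
  `N`, while their images under a compact operator would otherwise grow like `N`.

The numerical constants are not optimized.
-/

noncomputable section

namespace DiscSpaces

/-! ### Calculus of holomorphic functions on the disc -/

lemma IsHolo.hasDerivAt {f : 𝔻 → ℂ} (hf : IsHolo f) (z : 𝔻) :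
    HasDerivAt (zeroExt f) (DiscSpaces.discDeriv f z) z :=
  (hf.differentiableAt z).hasDerivAt

lemma eventually_zeroExt_eq {f : 𝔻 → ℂ} {F : ℂ → ℂ} (hF : ∀ z : 𝔻, F z = f z) (z : 𝔻) :
    zeroExt f =ᶠ[nhds (z : ℂ)] F := by
  filter_upwards [Metric.isOpen_ball.mem_nhds (coe_mem z)] with w hw
  rw [zeroExt_of_mem f hw, ← hF]
  rfl

/-- Holomorphy and the derivative on the disc may be read off from any function on the plane that
agrees with `f` on the disc. -/
lemma isHolo_and_discDeriv_eq {f f' : 𝔻 → ℂ} {F : ℂ → ℂ} (hF : ∀ z : 𝔻, F z = f z)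
    (h : ∀ z : 𝔻, HasDerivAt F (f' z) z) : IsHolo f ∧ discDeriv f = f' := by
  have key : ∀ z : 𝔻, HasDerivAt (zeroExt f) (f' z) z := fun z =>
    (h z).congr_of_eventuallyEq (eventually_zeroExt_eq hF z)
  refine ⟨fun z hz => ?_, funext fun z => (key z).deriv⟩
  exact (key (Complex.UnitDisc.mk z (mem_ball_zero_iff.1 hz))).differentiableAt
    |>.differentiableWithinAt

lemma isHolo_const (c : ℂ) : IsHolo (fun _ => c) ∧ discDeriv (fun _ => c) = 0 :=
  isHolo_and_discDeriv_eq (F := fun _ => c) (fun _ => rfl) fun z => hasDerivAt_const (z : ℂ) c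

lemma isHolo_idPow (n : ℕ) :
    IsHolo (idPow n) ∧ discDeriv (idPow n) = (n : ℂ) • idPow (n - 1) :=
  isHolo_and_discDeriv_eq (F := fun z => z ^ n) (fun _ => rfl) fun z => hasDerivAt_pow n (z : ℂ)

lemma isHolo_mul {f g : 𝔻 → ℂ} (hf : IsHolo f) (hg : IsHolo g) :
    IsHolo (f * g) ∧ discDeriv (f * g) = discDeriv f * g + f * discDeriv g :=
  isHolo_and_discDeriv_eq (F := zeroExt f * zeroExt g)
    (fun z => by simp [zeroExt_coe])
    fun z => by simpa [zeroExt_coe] using (hf.hasDerivAt z).mul (hg.hasDerivAt z)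

lemma isHolo_compOp {φ : 𝔻 → 𝔻} (hφ : IsHolo fun z => (φ z : ℂ)) {f : 𝔻 → ℂ} (hf : IsHolo f) :
    IsHolo (compOp φ f) ∧
      discDeriv (compOp φ f) = weightedCompOp (discDeriv fun z => (φ z : ℂ)) φ (discDeriv f) := by
  refine isHolo_and_discDeriv_eq (F := zeroExt f ∘ zeroExt fun z => (φ z : ℂ))
    (fun z => by simp [zeroExt_coe, compOp]) fun z => ?_
  have h := hf.hasDerivAt (φ z)
  rw [← zeroExt_coe (fun z => (φ z : ℂ)) z] at h
  rw [weightedCompOp, mul_comm]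
  exact h.comp (z : ℂ) (hφ.hasDerivAt z)

lemma isHolo_weightedCompOp {φ : 𝔻 → 𝔻} (hφ : IsHolo fun z => (φ z : ℂ)) {u f : 𝔻 → ℂ}
    (hu : IsHolo u) (hf : IsHolo f) :
    IsHolo (weightedCompOp u φ f) ∧ ∀ z, discDeriv (weightedCompOp u φ f) z =
      discDeriv u z * f (φ z) + u z * (discDeriv (fun z => (φ z : ℂ)) z * discDeriv f (φ z)) := by
  obtain ⟨h1, h2⟩ := isHolo_compOp hφ hf
  obtain ⟨h3, h4⟩ := isHolo_mul hu h1
  exact ⟨h3, fun z => by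
    change discDeriv (u * compOp φ f) z = _
    rw [h4, h2]
    rfl⟩

lemma isHolo_symbolPow {φ : 𝔻 → 𝔻} (hφ : IsHolo fun z => (φ z : ℂ)) (n : ℕ) :
    IsHolo (symbolPow φ n) ∧ ∀ z, discDeriv (symbolPow φ n) z =
      n * (φ z : ℂ) ^ (n - 1) * discDeriv (fun z => (φ z : ℂ)) z := by
  obtain ⟨h1, h2⟩ := isHolo_compOp hφ (isHolo_idPow n).1
  refine ⟨h1, fun z => ?_⟩
  change discDeriv (compOp φ (idPow n)) z = _
  rw [h2, (isHolo_idPow n).2]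
  simp [weightedCompOp, idPow]
  ring

lemma norm_smul_coe_lt_one {t : ℝ} (ht : t ∈ Set.Icc (0 : ℝ) 1) (z : 𝔻) :
    ‖(t : ℂ) * z‖ < 1 := by
  rw [norm_mul, Complex.norm_real, Real.norm_of_nonneg ht.1]
  exact (mul_le_of_le_one_left (norm_nonneg _) ht.2).trans_lt z.norm_lt_one

lemma primitive_zero (f : 𝔻 → ℂ) : primitive f 0 = 0 := by simp [primitive]

lemma hasDerivAt_segment {F : 𝔻 → ℂ} (hF : IsHolo F) (z : 𝔻) {t : ℝ}
    (ht : t ∈ Set.Icc (0 : ℝ) 1) : HasDerivAt (fun t : ℝ => zeroExt F ((t : ℂ) * z))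
      ((z : ℂ) * zeroExt (discDeriv F) ((t : ℂ) * z)) t := by
  have h1 := hF.hasDerivAt (Complex.UnitDisc.mk _ (norm_smul_coe_lt_one ht z))
  have h2 : HasDerivAt (fun t : ℝ => (t : ℂ) * z) (z : ℂ) t := by
    simpa using (Complex.ofRealCLM.hasDerivAt (x := t)).mul_const (z : ℂ)
  have h3 := HasDerivAt.scomp t h1 h2
  rw [smul_eq_mul, ← zeroExt_coe (discDeriv F)] at h3
  exact h3

/-- The fundamental theorem of calculus along the segment from `0` to `z`. -/
lemma primitive_discDeriv {F : 𝔻 → ℂ} (hF : IsHolo F) (z : 𝔻) :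
    primitive (discDeriv F) z = F z - F 0 := by
  have hc : IntervalIntegrable
      (fun t : ℝ => (z : ℂ) * zeroExt (discDeriv F) ((t : ℂ) * z)) MeasureTheory.volume 0 1 := by
    refine ContinuousOn.intervalIntegrable ?_
    rw [Set.uIcc_of_le zero_le_one]
    refine continuousOn_const.mul (hF.discDeriv.continuousOn.comp (by fun_prop) fun t ht => ?_)
    exact mem_ball_zero_iff.2 (norm_smul_coe_lt_one ht z)
  rw [primitive, intervalIntegral.integral_eq_sub_of_hasDerivAt (fun t ht =>
    hasDerivAt_segment hF z (by rwa [Set.uIcc_of_le zero_le_one] at ht)) hc]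
  have h0 : zeroExt F 0 = F 0 := zeroExt_coe F 0
  simp [zeroExt_coe, h0]

lemma isHolo_primitive {f : 𝔻 → ℂ} (hf : IsHolo f) :
    IsHolo (primitive f) ∧ discDeriv (primitive f) = f := by
  obtain ⟨F, hF⟩ := DifferentiableOn.isExactOn_ball hf
  obtain ⟨h1, h2⟩ := isHolo_and_discDeriv_eq (f := fun z => F z) (f' := f) (F := F)
    (fun _ => rfl) fun z => by simpa [zeroExt_coe] using hF z (coe_mem z)
  have h3 : primitive f = (fun z : 𝔻 => F z) + fun _ => -F (0 : 𝔻) := funext fun z => by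
    rw [← h2, primitive_discDeriv h1 z, sub_eq_add_neg]
    rfl
  have h4 := isHolo_const (-F (0 : 𝔻))
  exact h3 ▸ ⟨h1.add h4.1, by rw [discDeriv_add h1 h4.1, h2, h4.2, add_zero]⟩

/-! ### Norm estimates in the Bloch-type and Zygmund-type spaces -/

lemma ofReal_mul_enorm (v : Weight) (f : 𝔻 → ℂ) (z : 𝔻) :
    ENNReal.ofReal (v z) * ‖f z‖ₑ = ENNReal.ofReal (v z * ‖f z‖) := by
  rw [ENNReal.ofReal_mul (v.pos z).le, ofReal_norm]

lemma growthENorm_le_ofReal {v : Weight} {f : 𝔻 → ℂ} {B : ℝ} (h : ∀ z, v z * ‖f z‖ ≤ B) :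
    growthENorm v f ≤ ENNReal.ofReal B :=
  iSup_le fun z => by
    rw [ofReal_mul_enorm]
    exact ENNReal.ofReal_le_ofReal (h z)

lemma le_growthENorm (v : Weight) (f : 𝔻 → ℂ) (z : 𝔻) :
    ENNReal.ofReal (v z * ‖f z‖) ≤ growthENorm v f := by
  rw [← ofReal_mul_enorm]
  exact le_iSup (fun z => ENNReal.ofReal (v z) * ‖f z‖ₑ) z

lemma blochENorm_le_ofReal {v : Weight} {f : 𝔻 → ℂ} {B : ℝ} (h : ∀ z, v z * ‖discDeriv f z‖ ≤ B) :
    blochENorm v f ≤ ENNReal.ofReal (‖f 0‖ + B) := by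
  have hB : 0 ≤ B := (mul_nonneg (v.pos 0).le (norm_nonneg _)).trans (h 0)
  rw [ENNReal.ofReal_add (norm_nonneg _) hB, ofReal_norm]
  exact add_le_add le_rfl (growthENorm_le_ofReal h)

/-- The element of `B^v` given by a holomorphic function with a bound on `v |f'|`. -/
def Bloch.ofBound {v : Weight} (f : 𝔻 → ℂ) (hf : IsHolo f) (B : ℝ)
    (h : ∀ z, v z * ‖discDeriv f z‖ ≤ B) : Bloch v :=
  ⟨f, hf, (blochENorm_le_ofReal h).trans_lt ENNReal.ofReal_lt_top⟩

lemma Bloch.ext {v : Weight} {f g : Bloch v} (h : f.fn = g.fn) : f = g := Subtype.ext h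

lemma Zygmund.ext {v : Weight} {f g : Zygmund v} (h : f.fn = g.fn) : f = g := Subtype.ext h

lemma Bloch.isHolo {v : Weight} (f : Bloch v) : IsHolo f.fn := f.2.1

lemma Zygmund.isHolo {v : Weight} (f : Zygmund v) : IsHolo f.fn := f.2.1

lemma Bloch.fn_add {v : Weight} (f g : Bloch v) : (f + g).fn = f.fn + g.fn := rfl

lemma Bloch.fn_sub {v : Weight} (f g : Bloch v) : (f - g).fn = f.fn - g.fn := rfl

lemma Bloch.fn_smul {v : Weight} (c : ℂ) (f : Bloch v) : (c • f).fn = c • f.fn := rfl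

lemma Bloch.fn_zero {v : Weight} : (0 : Bloch v).fn = 0 := rfl

lemma Zygmund.fn_add {v : Weight} (f g : Zygmund v) : (f + g).fn = f.fn + g.fn := rfl

lemma Zygmund.fn_smul {v : Weight} (c : ℂ) (f : Zygmund v) : (c • f).fn = c • f.fn := rfl

lemma discDeriv_sub {f g : 𝔻 → ℂ} (hf : IsHolo f) (hg : IsHolo g) :
    discDeriv (f - g) = discDeriv f - discDeriv g := by
  have h : f - g = f + (-1 : ℂ) • g := by simp [sub_eq_add_neg]
  rw [h, discDeriv_add hf (hg.smul _), discDeriv_smul _ hg]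
  simp [sub_eq_add_neg]

lemma Bloch.ofReal_norm {v : Weight} (f : Bloch v) : ENNReal.ofReal ‖f‖ = blochENorm v f.fn :=
  ENNReal.ofReal_toReal f.2.2.ne

lemma Zygmund.ofReal_norm {v : Weight} (f : Zygmund v) :
    ENNReal.ofReal ‖f‖ = zygmundENorm v f.fn :=
  ENNReal.ofReal_toReal f.2.2.ne

lemma Bloch.norm_le {v : Weight} {f : Bloch v} {B : ℝ}
    (h : ∀ z, v z * ‖discDeriv f.fn z‖ ≤ B) : ‖f‖ ≤ ‖f.fn 0‖ + B := by
  have hB : 0 ≤ B := (mul_nonneg (v.pos 0).le (norm_nonneg _)).trans (h 0)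
  rw [← ENNReal.ofReal_le_ofReal_iff (by positivity), Bloch.ofReal_norm]
  exact blochENorm_le_ofReal h

lemma Bloch.norm_zero_add_le {v : Weight} (f : Bloch v) (z : 𝔻) :
    ‖f.fn 0‖ + v z * ‖discDeriv f.fn z‖ ≤ ‖f‖ := by
  have h0 : 0 ≤ v z * ‖discDeriv f.fn z‖ := mul_nonneg (v.pos z).le (norm_nonneg _)
  rw [← ENNReal.ofReal_le_ofReal_iff (norm_nonneg _), Bloch.ofReal_norm,
    ENNReal.ofReal_add (norm_nonneg _) h0, _root_.ofReal_norm]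
  exact add_le_add le_rfl (le_growthENorm _ _ z)

lemma Bloch.norm_apply_zero_le {v : Weight} (f : Bloch v) : ‖f.fn 0‖ ≤ ‖f‖ :=
  (le_add_of_nonneg_right (mul_nonneg (v.pos 0).le (norm_nonneg _))).trans (f.norm_zero_add_le 0)

lemma Bloch.weight_mul_norm_deriv_le {v : Weight} (f : Bloch v) (z : 𝔻) :
    v z * ‖discDeriv f.fn z‖ ≤ ‖f‖ :=
  (le_add_of_nonneg_left (norm_nonneg _)).trans (f.norm_zero_add_le z)

/-- Comparison along the segment from `0` to `z`: a bound on the derivative by that of a comparison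
function bounds the function. -/
lemma norm_le_of_deriv_le {h : 𝔻 → ℂ} (hh : IsHolo h) (h0 : h 0 = 0) (z : 𝔻) {B B' : ℝ → ℝ}
    (hB0 : 0 ≤ B 0) (hB : ∀ t ∈ Set.Icc (0 : ℝ) 1, HasDerivAt B (B' t) t)
    (bound : ∀ t ∈ Set.Icc (0 : ℝ) 1, ∀ ζ : 𝔻, (ζ : ℂ) = (t : ℂ) * z →
      ‖(z : ℂ)‖ * ‖discDeriv h ζ‖ ≤ B' t) : ‖h z‖ ≤ B 1 := by
  have := image_norm_le_of_norm_deriv_right_le_deriv_boundary' (a := 0) (b := 1)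
    (fun t ht => (hasDerivAt_segment hh z ht).continuousAt.continuousWithinAt)
    (fun t ht => (hasDerivAt_segment hh z (Set.Ico_subset_Icc_self ht)).hasDerivWithinAt)
    (by simpa [show zeroExt h 0 = h 0 from zeroExt_coe h 0, h0] using hB0)
    (fun t ht => (hB t ht).continuousAt.continuousWithinAt)
    (fun t ht => (hB t (Set.Ico_subset_Icc_self ht)).hasDerivWithinAt)
    (fun t ht => by
      have ht' := Set.Ico_subset_Icc_self ht
      have := bound t ht' (Complex.UnitDisc.mk _ (norm_smul_coe_lt_one ht' z)) rfl
      rw [← zeroExt_coe (discDeriv h)] at this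
      rw [norm_mul]
      exact this) (Set.right_mem_Icc.2 zero_le_one)
  simpa [zeroExt_coe] using this

/-! ### The two weights -/

lemma vLog_apply (z : 𝔻) : vLog z = (1 - ‖(z : ℂ)‖) * Real.log (2 / (1 - ‖(z : ℂ)‖)) := rfl

lemma wLog_apply (z : 𝔻) : wLog z = (Real.log (Real.log (4 / (1 - ‖(z : ℂ)‖ ^ 2))))⁻¹ := rfl

lemma quarter_le_loglog_four : 1 / 4 ≤ Real.log (Real.log 4) := by
  have h2 := Real.log_two_gt_d9
  have h4 : Real.log 4 = 2 * Real.log 2 := by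
    rw [show (4 : ℝ) = 2 ^ 2 by norm_num, Real.log_pow]; norm_num
  refine le_trans ?_ (Real.one_sub_inv_le_log_of_pos (zero_lt_one.trans one_lt_log_four))
  have : (Real.log 4)⁻¹ ≤ 3 / 4 := by
    rw [inv_le_comm₀ (zero_lt_one.trans one_lt_log_four) (by norm_num)]
    linarith
  linarith

/-- The function `t ↦ t log (2 / t)` is increasing on `(0, 1]` up to a factor. -/
lemma mul_log_le_mul_log {t τ : ℝ} (ht : 0 < t) (h : t ≤ τ) (hτ : τ ≤ 1) :
    t * Real.log (2 / t) ≤ 3 * (τ * Real.log (2 / τ)) := by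
  have hτ0 : 0 < τ := ht.trans_le h
  have h1 : Real.log (2 / t) = Real.log (2 / τ) + Real.log (τ / t) := by
    rw [← Real.log_mul (by positivity) (by positivity)]
    congr 1
    field_simp
  have h2 : Real.log (τ / t) ≤ τ / t := (Real.log_le_sub_one_of_pos (by positivity)).trans (by simp)
  have h3 : 1 / 2 ≤ Real.log (2 / τ) := by
    have : Real.log 2 ≤ Real.log (2 / τ) := by
      refine Real.log_le_log two_pos ?_
      rw [le_div_iff₀ hτ0]
      linarith
    linarith [Real.log_two_gt_d9]
  calc t * Real.log (2 / t) = t * Real.log (2 / τ) + t * Real.log (τ / t) := by rw [h1]; ring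
    _ ≤ τ * Real.log (2 / τ) + t * (τ / t) := by gcongr
    _ = τ * Real.log (2 / τ) + τ := by field_simp
    _ ≤ _ := by nlinarith

/-- The function `t ↦ t log log (4 / t)` is increasing on `(0, 1]` up to a factor. -/
lemma mul_loglog_le_mul_loglog {t τ : ℝ} (ht : 0 < t) (h : t ≤ τ) (hτ : τ ≤ 1) :
    t * Real.log (Real.log (4 / t)) ≤ 5 * (τ * Real.log (Real.log (4 / τ))) := by
  have hτ0 : 0 < τ := ht.trans_le h
  have h3 : Real.log 4 ≤ Real.log (4 / τ) := by
    refine Real.log_le_log four_pos ?_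
    rw [le_div_iff₀ hτ0]
    linarith
  have h4 := one_lt_log_four
  have hq : 1 / 4 ≤ Real.log (Real.log (4 / τ)) :=
    quarter_le_loglog_four.trans (Real.log_le_log (by linarith) h3)
  have h1 : Real.log (4 / t) = Real.log (4 / τ) + Real.log (τ / t) := by
    rw [← Real.log_mul (by positivity) (by positivity)]
    congr 1
    field_simp
  have h2 : Real.log (τ / t) ≤ τ / t := (Real.log_le_sub_one_of_pos (by positivity)).trans (by simp)
  have h0 : 0 ≤ Real.log (τ / t) := Real.log_nonneg (by rwa [le_div_iff₀ ht, one_mul])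
  have h5 : Real.log (Real.log (4 / t)) ≤ Real.log (Real.log (4 / τ)) + τ / t := by
    have hpos : 0 < Real.log (4 / τ) := by linarith
    have : Real.log (4 / t) = Real.log (4 / τ) * (1 + Real.log (τ / t) / Real.log (4 / τ)) := by
      rw [h1]; field_simp
    rw [this, Real.log_mul hpos.ne' (by positivity)]
    have h6 := Real.log_le_sub_one_of_pos
      (show 0 < 1 + Real.log (τ / t) / Real.log (4 / τ) by positivity)
    have h7 : Real.log (τ / t) / Real.log (4 / τ) ≤ Real.log (τ / t) :=
      div_le_self h0 (by linarith)
    linarith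
  calc t * Real.log (Real.log (4 / t))
      ≤ t * (Real.log (Real.log (4 / τ)) + τ / t) := by gcongr
    _ = t * Real.log (Real.log (4 / τ)) + τ := by field_simp
    _ ≤ τ * Real.log (Real.log (4 / τ)) + τ := by gcongr
    _ ≤ _ := by nlinarith

lemma vLog_le_of_norm_le {z s : 𝔻} (h : ‖(s : ℂ)‖ ≤ ‖(z : ℂ)‖) : vLog z ≤ 3 * vLog s := by
  have := z.norm_lt_one
  have := norm_nonneg (s : ℂ)
  exact mul_log_le_mul_log (by linarith) (by linarith) (by linarith)

lemma wLog_le_of_norm_le {z s : 𝔻} (h : ‖(s : ℂ)‖ ≤ ‖(z : ℂ)‖) : wLog z ≤ wLog s := by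
  have h1 := z.sq_norm_lt_one
  have h2 : ‖(s : ℂ)‖ ^ 2 ≤ ‖(z : ℂ)‖ ^ 2 := by gcongr
  have h3 := one_lt_log_four
  rw [wLog_apply, wLog_apply]
  refine inv_anti₀ (loglog_pos.trans_le (loglog_le s)) (Real.log_le_log
    (by linarith [log_four_le s]) (Real.log_le_log ?_ ?_))
  · exact div_pos four_pos (by linarith)
  · gcongr

lemma half_one_sub_le_vLog (z : 𝔻) : (1 - ‖(z : ℂ)‖) / 2 ≤ vLog z := by
  have h1 := z.norm_lt_one
  have h0 := norm_nonneg (z : ℂ)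
  have h2 : Real.log 2 ≤ Real.log (2 / (1 - ‖(z : ℂ)‖)) := by
    refine Real.log_le_log two_pos ?_
    rw [le_div_iff₀ (by linarith)]
    linarith
  have h3 := Real.log_two_gt_d9
  rw [vLog_apply]
  nlinarith

lemma vLog_le_three (z : 𝔻) : vLog z ≤ 3 := by
  have h := vLog_le_of_norm_le (z := z) (s := 0) (by simp)
  have h0 : vLog 0 = Real.log 2 := by simp [vLog_apply]
  linarith [Real.log_two_lt_d9]

/-- The weight `v_log` vanishes at the boundary. -/
lemma exists_vLog_le {ε : ℝ} (hε : 0 < ε) : ∃ ρ < 1, ∀ z : 𝔻, ρ < ‖(z : ℂ)‖ → vLog z ≤ ε := by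
  have hc : Continuous fun t : ℝ => t * Real.log 2 - t * Real.log t := by
    have := Real.continuous_mul_log
    fun_prop
  obtain ⟨δ, hδ, h⟩ := Metric.continuous_iff.1 hc 0 ε hε
  refine ⟨1 - δ, by linarith, fun z hz => ?_⟩
  have h1 := z.norm_lt_one
  have h2 := h (1 - ‖(z : ℂ)‖) (by
    rw [Real.dist_eq, abs_lt]
    constructor <;> linarith)
  rw [vLog_apply, Real.log_div two_ne_zero (by linarith), mul_sub]
  simpa using ((le_abs_self _).trans_lt h2).le

/-- The weight `w_log` vanishes at the boundary. -/
lemma exists_wLog_le {ε : ℝ} (hε : 0 < ε) : ∃ ρ < 1, ∀ z : 𝔻, ρ < ‖(z : ℂ)‖ → wLog z ≤ ε := by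
  refine ⟨1 - 2 * Real.exp (-Real.exp ε⁻¹), by linarith [Real.exp_pos (-Real.exp ε⁻¹)],
    fun z hz => ?_⟩
  have h1 := z.norm_lt_one
  have h0 := norm_nonneg (z : ℂ)
  have h2 := z.sq_norm_lt_one
  have h3 : Real.exp (Real.exp ε⁻¹) ≤ 4 / (1 - ‖(z : ℂ)‖ ^ 2) := by
    rw [le_div_iff₀ (by linarith)]
    have h4 : 1 - ‖(z : ℂ)‖ ^ 2 ≤ 4 * Real.exp (-Real.exp ε⁻¹) := by nlinarith
    calc _ ≤ Real.exp (Real.exp ε⁻¹) * (4 * Real.exp (-Real.exp ε⁻¹)) := by gcongr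
      _ = 4 * Real.exp (Real.exp ε⁻¹ + -Real.exp ε⁻¹) := by rw [Real.exp_add]; ring
      _ = 4 := by simp
  have h5 : ε⁻¹ ≤ Real.log (Real.log (4 / (1 - ‖(z : ℂ)‖ ^ 2))) := by
    have h6 := Real.log_le_log (Real.exp_pos _) h3
    rw [Real.log_exp] at h6
    simpa using Real.log_le_log (Real.exp_pos _) h6
  rw [wLog_apply, inv_le_comm₀ (loglog_pos.trans_le (loglog_le z)) hε]
  exact h5

lemma pow_mul_le_one {x : ℝ} (h0 : 0 ≤ x) (h1 : x ≤ 1) (n : ℕ) : x ^ n * (n * (1 - x)) ≤ 1 := by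
  have h2 := one_add_mul_le_pow (a := 1 - x) (by linarith) n
  have h3 : x ^ n * (1 + (1 - x)) ^ n ≤ 1 := by
    rw [← mul_pow]
    exact pow_le_one₀ (by nlinarith) (by nlinarith)
  have h4 : 0 ≤ x ^ n := by positivity
  nlinarith

/-- If `n (1 - |z|)` is about `1`, then `v_log(s) |s|^n` is almost largest at `s = z`. -/
lemma vLog_mul_pow_le {n : ℕ} {z : 𝔻} (h1 : 1 / 4 ≤ n * (1 - ‖(z : ℂ)‖))
    (h2 : n * (1 - ‖(z : ℂ)‖) ≤ 1 / 2) (s : 𝔻) :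
    vLog s * ‖(s : ℂ)‖ ^ n ≤ 80 * (vLog z * ‖(z : ℂ)‖ ^ n) := by
  have hz1 := z.norm_lt_one
  have hz0 := norm_nonneg (z : ℂ)
  have hs1 := s.norm_lt_one
  have hs0 := norm_nonneg (s : ℂ)
  have hv := vLog.pos z
  have hb : 1 / 2 ≤ ‖(z : ℂ)‖ ^ n := by
    have := one_add_mul_le_pow (a := ‖(z : ℂ)‖ - 1) (by linarith) n
    rw [add_sub_cancel] at this
    linarith
  have hn : 0 < (n : ℝ) := by
    by_contra h
    have : (n : ℝ) = 0 := le_antisymm (not_lt.1 h) n.cast_nonneg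
    rw [this] at h1
    linarith
  suffices h : vLog s * ‖(s : ℂ)‖ ^ n ≤ 4 * vLog z by nlinarith
  rcases le_total ‖(z : ℂ)‖ ‖(s : ℂ)‖ with hzs | hzs
  · have h3 := vLog_le_of_norm_le hzs
    have h4 := pow_le_one₀ hs0 hs1.le (n := n)
    have := vLog.pos s
    nlinarith
  · have h3 := pow_mul_le_one hs0 hs1.le n
    have h4 : Real.log (2 / (1 - ‖(s : ℂ)‖)) ≤ Real.log (2 / (1 - ‖(z : ℂ)‖)) := by
      refine Real.log_le_log (div_pos two_pos (by linarith)) ?_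
      gcongr
    have h5 : 0 ≤ Real.log (2 / (1 - ‖(z : ℂ)‖)) := by
      refine Real.log_nonneg ?_
      rw [le_div_iff₀ (by linarith)]
      linarith
    have h6 : ‖(s : ℂ)‖ ^ n * (1 - ‖(s : ℂ)‖) ≤ 4 * (1 - ‖(z : ℂ)‖) := by
      have : n * (‖(s : ℂ)‖ ^ n * (1 - ‖(s : ℂ)‖)) ≤ n * (4 * (1 - ‖(z : ℂ)‖)) := by linarith
      exact le_of_mul_le_mul_left this hn
    rw [vLog_apply, vLog_apply]
    calc _ = (‖(s : ℂ)‖ ^ n * (1 - ‖(s : ℂ)‖)) * Real.log (2 / (1 - ‖(s : ℂ)‖)) := by ring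
      _ ≤ (4 * (1 - ‖(z : ℂ)‖)) * Real.log (2 / (1 - ‖(z : ℂ)‖)) := by
        refine mul_le_mul h6 h4 (Real.log_nonneg ?_) (by linarith)
        rw [le_div_iff₀ (by linarith)]
        linarith
      _ = _ := by ring

/-- If `n (1 - |z|)` is about `1`, then `w_log(s) |s|^n` is almost largest at `s = z`. -/
lemma wLog_mul_pow_le {n : ℕ} {z : 𝔻} (h1 : 1 / 4 ≤ n * (1 - ‖(z : ℂ)‖))
    (h2 : n * (1 - ‖(z : ℂ)‖) ≤ 1 / 2) (s : 𝔻) :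
    wLog s * ‖(s : ℂ)‖ ^ n ≤ 80 * (wLog z * ‖(z : ℂ)‖ ^ n) := by
  have hz1 := z.norm_lt_one
  have hz0 := norm_nonneg (z : ℂ)
  have hs1 := s.norm_lt_one
  have hs0 := norm_nonneg (s : ℂ)
  have hv := wLog.pos z
  have hws := wLog.pos s
  have hb : 1 / 2 ≤ ‖(z : ℂ)‖ ^ n := by
    have := one_add_mul_le_pow (a := ‖(z : ℂ)‖ - 1) (by linarith) n
    rw [add_sub_cancel] at this
    linarith
  have hn : 0 < (n : ℝ) := by
    by_contra h
    have : (n : ℝ) = 0 := le_antisymm (not_lt.1 h) n.cast_nonneg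
    rw [this] at h1
    linarith
  suffices h : wLog s * ‖(s : ℂ)‖ ^ n ≤ 40 * wLog z by nlinarith
  rcases le_total ‖(z : ℂ)‖ ‖(s : ℂ)‖ with hzs | hzs
  · have h3 := wLog_le_of_norm_le hzs
    have h4 := pow_le_one₀ hs0 hs1.le (n := n)
    nlinarith
  · have h3 := pow_mul_le_one hs0 hs1.le n
    have h6 : ‖(s : ℂ)‖ ^ n * (1 - ‖(s : ℂ)‖) ≤ 4 * (1 - ‖(z : ℂ)‖) := by
      have : n * (‖(s : ℂ)‖ ^ n * (1 - ‖(s : ℂ)‖)) ≤ n * (4 * (1 - ‖(z : ℂ)‖)) := by linarith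
      exact le_of_mul_le_mul_left this hn
    have hsz : ‖(s : ℂ)‖ ^ 2 ≤ ‖(z : ℂ)‖ ^ 2 := by gcongr
    have h7 := mul_loglog_le_mul_loglog (t := 1 - ‖(z : ℂ)‖ ^ 2) (τ := 1 - ‖(s : ℂ)‖ ^ 2)
      (by nlinarith) (by linarith) (by nlinarith)
    rw [← inv_inv (Real.log (Real.log (4 / (1 - ‖(z : ℂ)‖ ^ 2)))), ← wLog_apply,
      ← inv_inv (Real.log (Real.log (4 / (1 - ‖(s : ℂ)‖ ^ 2)))), ← wLog_apply,
      ← div_eq_mul_inv, ← div_eq_mul_inv, ← mul_div_assoc, div_le_div_iff₀ hv hws] at h7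
    have h8 : 0 ≤ ‖(s : ℂ)‖ ^ n := by positivity
    -- multiply the comparison of `t log log (4 / t)` by `|s|^n` and cancel `1 - |s|^2`
    have hp : 0 < 1 - ‖(z : ℂ)‖ := by linarith
    have hq : (1 - ‖(z : ℂ)‖) * wLog s ≤ 10 * ((1 - ‖(s : ℂ)‖) * wLog z) := by
      nlinarith [mul_nonneg hp.le hws.le, mul_nonneg (sub_pos.2 hs1).le hv.le]
    have hs : 0 < 1 - ‖(s : ℂ)‖ := by linarith
    have : (1 - ‖(s : ℂ)‖) * (wLog s * ‖(s : ℂ)‖ ^ n) ≤ (1 - ‖(s : ℂ)‖) * (40 * wLog z) := by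
      nlinarith
    exact le_of_mul_le_mul_left this hs

/-- Near the boundary, monomials of high degree are almost extremal for both weights at once. -/
lemma exists_pow_almost_extremal (N : ℕ) : ∃ ρ < 1, ∀ z : 𝔻, ρ < ‖(z : ℂ)‖ → ∃ n ≥ N,
    ∀ s : 𝔻, vLog s * ‖(s : ℂ)‖ ^ n ≤ 80 * (vLog z * ‖(z : ℂ)‖ ^ n) ∧
      wLog s * ‖(s : ℂ)‖ ^ n ≤ 80 * (wLog z * ‖(z : ℂ)‖ ^ n) := by
  refine ⟨max (3 / 4) (1 - 1 / (2 * (N + 1))), max_lt (by norm_num) ?_, fun z hz => ?_⟩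
  · have : (0 : ℝ) < 1 / (2 * (N + 1)) := by positivity
    linarith
  have hz1 := z.norm_lt_one
  obtain ⟨hz2, hz3⟩ := max_lt_iff.1 hz
  set t := 1 - ‖(z : ℂ)‖ with ht
  have ht0 : 0 < t := by linarith
  have hfl := Nat.floor_le (show 0 ≤ 1 / (2 * t) by positivity)
  have hlt := Nat.lt_floor_add_one (1 / (2 * t))
  have he : 1 / (2 * t) * t = 1 / 2 := by field_simp
  have hb1 : 1 / 4 ≤ ⌊1 / (2 * t)⌋₊ * t := by nlinarith
  have hb2 : ⌊1 / (2 * t)⌋₊ * t ≤ 1 / 2 := by nlinarith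
  refine ⟨⌊1 / (2 * t)⌋₊, Nat.le_floor ?_, fun s => ⟨vLog_mul_pow_le hb1 hb2 s,
    wLog_mul_pow_le hb1 hb2 s⟩⟩
  rw [le_div_iff₀ (by positivity)]
  have h4 : t < 1 / (2 * (N + 1)) := by linarith
  rw [lt_div_iff₀ (by positivity)] at h4
  nlinarith

/-- Integrating `1 / v_log` along a radius gives the growth `1 / w_log` of functions in the
Bloch-type space. -/
lemma norm_le_div_wLog {h : 𝔻 → ℂ} (hh : IsHolo h) (h0 : h 0 = 0) {M : ℝ}
    (hM : ∀ z, vLog z * ‖discDeriv h z‖ ≤ M) (z : 𝔻) : ‖h z‖ ≤ 3 * M / wLog z := by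
  have hM0 : 0 ≤ M := (mul_nonneg (vLog.pos 0).le (norm_nonneg _)).trans (hM 0)
  set x := ‖(z : ℂ)‖ with hx
  have hx1 : x < 1 := z.norm_lt_one
  have hx0 : 0 ≤ x := norm_nonneg _
  have hpos : ∀ t ∈ Set.Icc (0 : ℝ) 1, 0 < 1 - t * x := fun t ht => by nlinarith [ht.1, ht.2]
  have hlog : ∀ t ∈ Set.Icc (0 : ℝ) 1, 0 < Real.log (2 / (1 - t * x)) := fun t ht => by
    refine Real.log_pos ?_
    rw [lt_div_iff₀ (hpos t ht)]
    nlinarith [ht.1]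
  have key := norm_le_of_deriv_le hh h0 z
    (B := fun t => M * (Real.log (Real.log (2 / (1 - t * x))) - Real.log (Real.log 2)))
    (B' := fun t => M * (x / ((1 - t * x) * Real.log (2 / (1 - t * x))))) (by simp)
    (fun t ht => by
      have e1 : HasDerivAt (fun t => 1 - t * x) (-x) t := by
        simpa using (hasDerivAt_id t).mul_const x |>.const_sub 1
      have e2 := (e1.fun_inv (hpos t ht).ne').const_mul 2
      have e3 := (e2.log (mul_pos two_pos (inv_pos.2 (hpos t ht))).ne')
      have e4 := (e3.log (by rw [← div_eq_mul_inv]; exact (hlog t ht).ne')).sub_const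
        (Real.log (Real.log 2)) |>.const_mul M
      simp only [← div_eq_mul_inv] at e4
      refine e4.congr_deriv (Eq.symm ?_)
      have := hpos t ht
      have := hlog t ht
      field_simp)
    (fun t ht ζ hζ => by
      have hn : ‖(ζ : ℂ)‖ = t * x := by
        rw [hζ, norm_mul, Complex.norm_real, Real.norm_of_nonneg ht.1]
      have h1 := hM ζ
      rw [vLog_apply, hn] at h1
      have h2 : 0 < (1 - t * x) * Real.log (2 / (1 - t * x)) := mul_pos (hpos t ht) (hlog t ht)
      rw [← mul_div_assoc, le_div_iff₀ h2]
      nlinarith)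
  refine key.trans ?_
  rw [wLog_apply, div_inv_eq_mul, one_mul]
  have hl2 := Real.log_two_gt_d9
  have h1 : Real.log (Real.log (2 / (1 - x))) ≤ Real.log (Real.log (4 / (1 - x ^ 2))) := by
    have := hlog 1 (by simp)
    rw [one_mul] at this
    refine Real.log_le_log this (Real.log_le_log (div_pos two_pos (by linarith)) ?_)
    rw [div_le_div_iff₀ (by linarith) (by nlinarith)]
    nlinarith
  have h2 : -Real.log (Real.log 2) ≤ 1 / 2 := by
    have := Real.one_sub_inv_le_log_of_pos (show 0 < Real.log 2 by linarith)
    have h3 : (Real.log 2)⁻¹ ≤ 3 / 2 := by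
      rw [inv_le_comm₀ (by linarith) (by norm_num)]
      linarith
    linarith
  have h3 := quarter_le_loglog_four.trans (loglog_le z)
  rw [← hx] at h3
  nlinarith

/-! ### Test functions -/

/-- The function `log log (4 / (1 - \bar a z))`, with the principal branches of the logarithms. -/
def logLog (a : 𝔻) : 𝔻 → ℂ := fun z =>
  Complex.log ((Real.log 4 : ℝ) - Complex.log (1 - starRingEnd ℂ a * z))

section LogLog

variable (a z : 𝔻)

lemma norm_conj_mul_lt_one : ‖starRingEnd ℂ (a : ℂ) * z‖ < 1 := by
  rw [norm_mul, RCLike.norm_conj]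
  exact mul_lt_one_of_nonneg_of_lt_one_left (norm_nonneg _) a.norm_lt_one z.norm_lt_one.le

lemma re_one_sub_pos : 0 < (1 - starRingEnd ℂ (a : ℂ) * z).re := by
  have h := (Complex.re_le_norm _).trans_lt (norm_conj_mul_lt_one a z)
  rw [Complex.sub_re, Complex.one_re]
  linarith

lemma one_sub_ne_zero : 1 - starRingEnd ℂ (a : ℂ) * z ≠ 0 := fun h => by
  have := re_one_sub_pos a z
  rw [h] at this
  simp at this

lemma norm_one_sub_le : ‖1 - starRingEnd ℂ (a : ℂ) * z‖ ≤ 2 := by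
  have h := norm_sub_le 1 (starRingEnd ℂ (a : ℂ) * z)
  have := norm_conj_mul_lt_one a z
  rw [norm_one] at h
  linarith

lemma one_sub_mul_norm_le : 1 - ‖(a : ℂ)‖ * ‖(z : ℂ)‖ ≤ ‖1 - starRingEnd ℂ (a : ℂ) * z‖ := by
  have h := norm_sub_norm_le 1 (starRingEnd ℂ (a : ℂ) * z)
  rwa [norm_one, norm_mul, RCLike.norm_conj] at h

lemma one_sub_norm_le_right : 1 - ‖(z : ℂ)‖ ≤ ‖1 - starRingEnd ℂ (a : ℂ) * z‖ := by
  have := one_sub_mul_norm_le a z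
  have := a.norm_lt_one
  have := norm_nonneg (z : ℂ)
  nlinarith

lemma one_sub_norm_le_left : 1 - ‖(a : ℂ)‖ ≤ ‖1 - starRingEnd ℂ (a : ℂ) * z‖ := by
  have := one_sub_mul_norm_le a z
  have := z.norm_lt_one
  have := norm_nonneg (a : ℂ)
  nlinarith

lemma re_inner_log : ((Real.log 4 : ℝ) - Complex.log (1 - starRingEnd ℂ (a : ℂ) * z)).re =
    Real.log (4 / ‖1 - starRingEnd ℂ (a : ℂ) * z‖) := by
  rw [Real.log_div four_ne_zero (norm_ne_zero_iff.2 (one_sub_ne_zero a z)), Complex.sub_re,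
    Complex.log_re, Complex.ofReal_re]

lemma log_two_le : Real.log 2 ≤ Real.log (4 / ‖1 - starRingEnd ℂ (a : ℂ) * z‖) := by
  have := norm_one_sub_le a z
  refine Real.log_le_log two_pos ?_
  rw [le_div_iff₀ (norm_pos_iff.2 (one_sub_ne_zero a z))]
  linarith

lemma log_le_norm_inner_log : Real.log (4 / ‖1 - starRingEnd ℂ (a : ℂ) * z‖) ≤
    ‖(Real.log 4 : ℝ) - Complex.log (1 - starRingEnd ℂ (a : ℂ) * z)‖ := by
  rw [← re_inner_log]
  exact Complex.re_le_norm _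

lemma isHolo_logLog : IsHolo (logLog a) ∧ discDeriv (logLog a) = fun z : 𝔻 =>
    starRingEnd ℂ (a : ℂ) / ((1 - starRingEnd ℂ (a : ℂ) * z) *
      ((Real.log 4 : ℝ) - Complex.log (1 - starRingEnd ℂ (a : ℂ) * z))) := by
  refine isHolo_and_discDeriv_eq (F := fun z => Complex.log ((Real.log 4 : ℝ) -
    Complex.log (1 - starRingEnd ℂ a * z))) (fun _ => rfl) fun z => ?_
  have h1 : HasDerivAt (fun w : ℂ => 1 - starRingEnd ℂ (a : ℂ) * w) (-starRingEnd ℂ (a : ℂ)) z := by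
    simpa using ((hasDerivAt_id (z : ℂ)).const_mul (starRingEnd ℂ (a : ℂ))).const_sub 1
  have hs : (Real.log 4 : ℝ) - Complex.log (1 - starRingEnd ℂ (a : ℂ) * z) ∈ Complex.slitPlane := by
    left
    rw [re_inner_log]
    linarith [log_two_le a z, Real.log_two_gt_d9]
  have h2 := ((h1.clog (Or.inl (re_one_sub_pos a z))).const_sub ((Real.log 4 : ℝ) : ℂ)).clog hs
  refine h2.congr_deriv ?_
  rw [neg_div, neg_div, neg_div, neg_neg, div_div]

/-- The derivative of the test functions is uniformly of the size that `v_log` allows. -/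
lemma vLog_mul_norm_deriv_logLog_le : vLog z * ‖discDeriv (logLog a) z‖ ≤ 3 := by
  rw [(isHolo_logLog a).2]
  simp only [norm_div, norm_mul, RCLike.norm_conj]
  have hq : 0 < ‖1 - starRingEnd ℂ (a : ℂ) * z‖ := norm_pos_iff.2 (one_sub_ne_zero a z)
  have h1 := log_le_norm_inner_log a z
  have h2 := log_two_le a z
  have h3 := Real.log_two_gt_d9
  have h4 := one_sub_norm_le_right a z
  have h5 := norm_one_sub_le a z
  have h6 := z.norm_lt_one
  have h7 := a.norm_lt_one
  set q := ‖1 - starRingEnd ℂ (a : ℂ) * z‖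
  set l := ‖(Real.log 4 : ℝ) - Complex.log (1 - starRingEnd ℂ (a : ℂ) * z)‖
  set t := 1 - ‖(z : ℂ)‖ with ht
  have ht0 : 0 < t := by linarith
  have h8 := mul_log_le_mul_log (t := t / 2) (τ := q / 2) (by positivity) (by linarith)
    (by linarith)
  rw [show 2 / (t / 2) = 4 / t by field_simp; norm_num,
    show 2 / (q / 2) = 4 / q by field_simp; norm_num] at h8
  have h9 : Real.log (2 / t) ≤ Real.log (4 / t) := by
    refine Real.log_le_log (by positivity) ?_
    gcongr
    norm_num
  have h10 : vLog z ≤ 3 * (q * l) := by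
    rw [vLog_apply, ← ht]
    calc t * Real.log (2 / t) ≤ t * Real.log (4 / t) := by gcongr
      _ ≤ 3 * (q * Real.log (4 / q)) := by linarith
      _ ≤ 3 * (q * l) := by gcongr
  have hl : 0 < q * l := mul_pos hq (by linarith)
  rw [← mul_div_assoc, div_le_iff₀ hl]
  have := vLog.pos z
  nlinarith

/-- For fixed `a` the derivative of the test function is bounded. -/
lemma norm_deriv_logLog_le : ‖discDeriv (logLog a) z‖ ≤ 2 / (1 - ‖(a : ℂ)‖) := by
  rw [(isHolo_logLog a).2]
  simp only [norm_div, norm_mul, RCLike.norm_conj]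
  have h1 := (log_two_le a z).trans (log_le_norm_inner_log a z)
  have h3 := Real.log_two_gt_d9
  have h4 := one_sub_norm_le_left a z
  have h7 := a.norm_lt_one
  set q := ‖1 - starRingEnd ℂ (a : ℂ) * z‖
  set l := ‖(Real.log 4 : ℝ) - Complex.log (1 - starRingEnd ℂ (a : ℂ) * z)‖
  have hq : 0 < q := by linarith
  rw [div_le_div_iff₀ (mul_pos hq (by linarith)) (by linarith)]
  nlinarith [norm_nonneg (a : ℂ)]

lemma norm_logLog_le_of_le {c : 𝔻} (hc : 1 - ‖(c : ℂ)‖ ≤ ‖1 - starRingEnd ℂ (a : ℂ) * z‖) :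
    ‖logLog a z‖ ≤ 33 / wLog c := by
  have h1 := (log_two_le a z).trans (log_le_norm_inner_log a z)
  have h2 := Real.log_two_gt_d9
  have h2' := Real.log_two_lt_d9
  have hW := quarter_le_loglog_four.trans (loglog_le c)
  have hE := one_lt_log_four.trans_le (log_four_le c)
  rw [wLog_apply, div_inv_eq_mul]
  have hpi := Real.pi_lt_d2
  have hre : Real.log (4 / ‖1 - starRingEnd ℂ (a : ℂ) * z‖) ≤
      Real.log 2 + Real.log (4 / (1 - ‖(c : ℂ)‖ ^ 2)) := by
    have h3 := c.norm_lt_one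
    have h4 := c.sq_norm_lt_one
    rw [← Real.log_mul two_ne_zero (div_pos four_pos (by linarith)).ne']
    have hq : 0 < ‖1 - starRingEnd ℂ (a : ℂ) * z‖ := by linarith
    refine Real.log_le_log (by positivity) ?_
    rw [← mul_div_assoc, div_le_div_iff₀ hq (by linarith)]
    nlinarith [norm_nonneg (c : ℂ)]
  set E := Real.log (4 / (1 - ‖(c : ℂ)‖ ^ 2))
  have hl : ‖(Real.log 4 : ℝ) - Complex.log (1 - starRingEnd ℂ (a : ℂ) * z)‖ ≤ 5 * E := by
    refine (Complex.norm_le_abs_re_add_abs_im _).trans ?_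
    rw [re_inner_log, abs_of_nonneg (by linarith [log_two_le a z])]
    have : |((Real.log 4 : ℝ) - Complex.log (1 - starRingEnd ℂ (a : ℂ) * z)).im| ≤ Real.pi := by
      rw [Complex.sub_im, Complex.ofReal_im, zero_sub, abs_neg, Complex.log_im]
      exact Complex.abs_arg_le_pi _
    linarith
  unfold logLog
  set l := (Real.log 4 : ℝ) - Complex.log (1 - starRingEnd ℂ (a : ℂ) * z)
  refine (Complex.norm_le_abs_re_add_abs_im _).trans ?_
  rw [Complex.log_re, Complex.log_im]
  have h5 := Complex.abs_arg_le_pi l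
  have h6 : |Real.log ‖l‖| ≤ Real.log E + 4 := by
    rw [abs_le]
    constructor
    · have h7 := Real.one_sub_inv_le_log_of_pos (show 0 < ‖l‖ by linarith)
      have h8 : ‖l‖⁻¹ ≤ 2 := by
        rw [inv_le_comm₀ (by linarith) two_pos]
        linarith
      linarith
    · have h7 := Real.log_le_log (by linarith) hl
      rw [Real.log_mul (by norm_num) (by linarith)] at h7
      have h8 := Real.log_le_sub_one_of_pos (show (0 : ℝ) < 5 by norm_num)
      linarith
  linarith

lemma norm_logLog_le_left : ‖logLog a z‖ ≤ 33 / wLog a :=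
  norm_logLog_le_of_le a z (one_sub_norm_le_left a z)

lemma norm_logLog_le_right : ‖logLog a z‖ ≤ 33 / wLog z :=
  norm_logLog_le_of_le a z (one_sub_norm_le_right a z)

lemma conj_mul_self_eq : starRingEnd ℂ (a : ℂ) * a = ((‖(a : ℂ)‖ ^ 2 : ℝ) : ℂ) := by
  rw [Complex.conj_mul', Complex.ofReal_pow]

lemma inner_log_self : (Real.log 4 : ℝ) - Complex.log (1 - starRingEnd ℂ (a : ℂ) * a) =
    ((Real.log (4 / (1 - ‖(a : ℂ)‖ ^ 2)) : ℝ) : ℂ) := by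
  have h := a.sq_norm_lt_one
  rw [conj_mul_self_eq, ← Complex.ofReal_one, ← Complex.ofReal_sub,
    ← Complex.ofReal_log (by linarith), ← Complex.ofReal_sub,
    Real.log_div four_ne_zero (by linarith)]

lemma logLog_self : logLog a a = (((wLog a)⁻¹ : ℝ) : ℂ) := by
  have h := one_lt_log_four.trans_le (log_four_le a)
  rw [logLog, inner_log_self, ← Complex.ofReal_log (by linarith), wLog_apply, inv_inv]

/-- The derivative of the test function at its base point attains the order `1 / v_log(a)`. -/
lemma one_le_vLog_mul_norm_deriv_logLog (ha : 1 / 2 ≤ ‖(a : ℂ)‖) :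
    1 ≤ 8 * (vLog a * ‖discDeriv (logLog a) a‖) := by
  have h1 := a.norm_lt_one
  have h2 := a.sq_norm_lt_one
  have hE := one_lt_log_four.trans_le (log_four_le a)
  have hval : ‖discDeriv (logLog a) a‖ = ‖(a : ℂ)‖ /
      ((1 - ‖(a : ℂ)‖ ^ 2) * Real.log (4 / (1 - ‖(a : ℂ)‖ ^ 2))) := by
    rw [(isHolo_logLog a).2]
    beta_reduce
    rw [inner_log_self, conj_mul_self_eq, norm_div, norm_mul, RCLike.norm_conj]
    rw [← Complex.ofReal_one, ← Complex.ofReal_sub, Complex.norm_real, Complex.norm_real,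
      Real.norm_of_nonneg (by linarith), Real.norm_of_nonneg (by linarith)]
  have hpos : 0 < (1 - ‖(a : ℂ)‖ ^ 2) * Real.log (4 / (1 - ‖(a : ℂ)‖ ^ 2)) :=
    mul_pos (by linarith) (by linarith)
  rw [hval, ← mul_div_assoc, ← mul_div_assoc, le_div_iff₀ hpos, one_mul, vLog_apply]
  set t := 1 - ‖(a : ℂ)‖ with ht
  have ht0 : 0 < t := by linarith
  have hL : Real.log (4 / (1 - ‖(a : ℂ)‖ ^ 2)) ≤ 2 * Real.log (2 / t) := by
    have h3 : Real.log (4 / (1 - ‖(a : ℂ)‖ ^ 2)) ≤ Real.log ((2 / t) ^ 2) := by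
      refine Real.log_le_log (div_pos four_pos (by linarith)) ?_
      rw [div_pow, div_le_div_iff₀ (by linarith) (by positivity)]
      nlinarith
    rwa [Real.log_pow, Nat.cast_two] at h3
  calc (1 - ‖(a : ℂ)‖ ^ 2) * Real.log (4 / (1 - ‖(a : ℂ)‖ ^ 2))
      ≤ (2 * t) * (2 * Real.log (2 / t)) := by
        refine mul_le_mul (by nlinarith) hL (by linarith) (by linarith)
    _ ≤ _ := by
      have : 0 ≤ t * Real.log (2 / t) := mul_nonneg ht0.le (by linarith)
      nlinarith

end LogLog

/-- The test function `α w(a) L_a ^ 2 + β w(a) ^ 2 L_a ^ 3`, where `w = w_log` and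
`L_a(z) = log log (4 / (1 - \bar a z))`. Here `w(a) = 1 / L_a(a)`, so that suitable `α` and `β`
make either the value or the derivative vanish at `a`. -/
def testFn (α β : ℝ) (a : 𝔻) : 𝔻 → ℂ :=
  ((α * wLog a : ℝ) : ℂ) • (logLog a * logLog a) +
    ((β * wLog a ^ 2 : ℝ) : ℂ) • (logLog a * (logLog a * logLog a))

lemma testFn_apply (α β : ℝ) (a z : 𝔻) : testFn α β a z =
    α * wLog a * logLog a z ^ 2 + β * wLog a ^ 2 * logLog a z ^ 3 := by
  simp [testFn]
  ring

lemma isHolo_testFn (α β : ℝ) (a : 𝔻) : IsHolo (testFn α β a) ∧ ∀ z, discDeriv (testFn α β a) z =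
    discDeriv (logLog a) z * (wLog a * logLog a z) * (2 * α + 3 * β * (wLog a * logLog a z)) := by
  have h1 := isHolo_logLog a
  have h2 := isHolo_mul h1.1 h1.1
  have h3 := isHolo_mul h1.1 h2.1
  refine ⟨(h2.1.smul _).add (h3.1.smul _), fun z => ?_⟩
  rw [testFn, discDeriv_add (h2.1.smul _) (h3.1.smul _), discDeriv_smul _ h2.1,
    discDeriv_smul _ h3.1, h3.2, h2.2]
  simp
  ring

section TestFn

variable {α β : ℝ} (hα : |α| ≤ 3) (hβ : |β| ≤ 3) (a z : 𝔻)

lemma norm_wLog_mul_logLog_le : ‖(wLog a : ℂ) * logLog a z‖ ≤ 33 := by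
  have h := norm_logLog_le_left a z
  have hw := wLog.pos a
  rw [le_div_iff₀ hw] at h
  rw [norm_mul, Complex.norm_real, Real.norm_of_nonneg hw.le]
  linarith

lemma norm_wLog_mul_logLog_le' : ‖(wLog a : ℂ) * logLog a z‖ ≤ 33 * (wLog a / wLog z) := by
  have h := norm_logLog_le_right a z
  have hw := wLog.pos a
  rw [norm_mul, Complex.norm_real, Real.norm_of_nonneg hw.le]
  calc _ ≤ wLog a * (33 / wLog z) := by gcongr
    _ = _ := by ring

include hα hβ

lemma norm_deriv_testFn_le : ‖discDeriv (testFn α β a) z‖ ≤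
    303 * (‖discDeriv (logLog a) z‖ * ‖(wLog a : ℂ) * logLog a z‖) := by
  have h1 := norm_wLog_mul_logLog_le a z
  rw [(isHolo_testFn α β a).2, norm_mul, norm_mul]
  have h2 : ‖2 * (α : ℂ) + 3 * β * (wLog a * logLog a z)‖ ≤ 303 := by
    refine (norm_add_le _ _).trans ?_
    rw [norm_mul, norm_mul, norm_mul, Complex.norm_real, Complex.norm_real, Real.norm_eq_abs,
      Real.norm_eq_abs, Complex.norm_two, Complex.norm_ofNat]
    nlinarith [norm_nonneg ((wLog a : ℂ) * logLog a z), abs_nonneg β]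
  rw [mul_comm (303 : ℝ)]
  gcongr

lemma vLog_mul_norm_deriv_testFn_le' :
    vLog z * ‖discDeriv (testFn α β a) z‖ ≤ 30000 * (wLog a / wLog z) := by
  have h1 := vLog_mul_norm_deriv_logLog_le a z
  have h2 := norm_wLog_mul_logLog_le' a z
  have h3 := norm_deriv_testFn_le hα hβ a z
  have hv := (vLog.pos z).le
  have hw : 0 ≤ wLog a / wLog z := (div_pos (wLog.pos a) (wLog.pos z)).le
  calc vLog z * ‖discDeriv (testFn α β a) z‖
      ≤ vLog z * (303 * (‖discDeriv (logLog a) z‖ * ‖(wLog a : ℂ) * logLog a z‖)) := by gcongr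
    _ = 303 * ((vLog z * ‖discDeriv (logLog a) z‖) * ‖(wLog a : ℂ) * logLog a z‖) := by ring
    _ ≤ 303 * (3 * (33 * (wLog a / wLog z))) := by gcongr
    _ ≤ _ := by linarith

lemma vLog_mul_norm_deriv_testFn_le : vLog z * ‖discDeriv (testFn α β a) z‖ ≤ 30000 := by
  have h1 := vLog_mul_norm_deriv_logLog_le a z
  have h2 := norm_wLog_mul_logLog_le a z
  have h3 := norm_deriv_testFn_le hα hβ a z
  have hv := (vLog.pos z).le
  calc vLog z * ‖discDeriv (testFn α β a) z‖
      ≤ vLog z * (303 * (‖discDeriv (logLog a) z‖ * ‖(wLog a : ℂ) * logLog a z‖)) := by gcongr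
    _ = 303 * ((vLog z * ‖discDeriv (logLog a) z‖) * ‖(wLog a : ℂ) * logLog a z‖) := by ring
    _ ≤ 303 * (3 * 33) := by gcongr
    _ ≤ _ := by norm_num

lemma norm_deriv_testFn_le' :
    ‖discDeriv (testFn α β a) z‖ ≤ 303 * (2 / (1 - ‖(a : ℂ)‖) * 33) := by
  have h1 := norm_deriv_logLog_le a z
  have h2 := norm_wLog_mul_logLog_le a z
  refine (norm_deriv_testFn_le hα hβ a z).trans ?_
  have : 0 ≤ 2 / (1 - ‖(a : ℂ)‖) := (norm_nonneg _).trans h1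
  gcongr

lemma norm_testFn_zero_le : ‖testFn α β a 0‖ ≤ 120000 * wLog a := by
  have h1 := norm_wLog_mul_logLog_le a 0
  have h2 : ‖logLog a 0‖ ≤ 33 := by
    refine (norm_logLog_le_right a 0).trans ?_
    have h3 : Real.log (Real.log 4) ≤ 1 := by
      have h4 := Real.log_le_sub_one_of_pos (zero_lt_one.trans one_lt_log_four)
      have h5 : Real.log 4 = 2 * Real.log 2 := by
        rw [show (4 : ℝ) = 2 ^ 2 by norm_num, Real.log_pow]; norm_num
      linarith [Real.log_two_lt_d9]
    have h4 : (33 : ℝ) / wLog 0 = 33 * Real.log (Real.log 4) := by simp [wLog_apply]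
    rw [h4]
    linarith
  have hw := (wLog.pos a).le
  have e : testFn α β a 0 =
      (wLog a * logLog a 0 ^ 2) * (α + β * (wLog a * logLog a 0)) := by
    rw [testFn_apply]; ring
  rw [e, norm_mul, norm_mul, norm_pow, Complex.norm_real, Real.norm_of_nonneg hw]
  have h5 : ‖(α : ℂ) + β * (wLog a * logLog a 0)‖ ≤ 102 := by
    refine (norm_add_le _ _).trans ?_
    rw [norm_mul, Complex.norm_real, Complex.norm_real, Real.norm_eq_abs, Real.norm_eq_abs]
    nlinarith [norm_nonneg ((wLog a : ℂ) * logLog a 0), abs_nonneg β]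
  calc _ ≤ wLog a * 33 ^ 2 * 102 := by gcongr
    _ ≤ _ := by linarith

end TestFn

lemma testFn_self (α β : ℝ) (a : 𝔻) :
    testFn α β a a = (((α + β) / wLog a : ℝ) : ℂ) := by
  have h : (wLog a : ℂ) ≠ 0 := Complex.ofReal_ne_zero.2 (wLog.pos a).ne'
  rw [testFn_apply, logLog_self]
  push_cast
  field_simp

lemma discDeriv_testFn_self (α β : ℝ) (a : 𝔻) :
    discDeriv (testFn α β a) a = discDeriv (logLog a) a * (2 * α + 3 * β : ℝ) := by
  have h : (wLog a : ℂ) ≠ 0 := Complex.ofReal_ne_zero.2 (wLog.pos a).ne'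
  rw [(isHolo_testFn α β a).2, logLog_self]
  push_cast
  field_simp

/-! ### Compact operators on sequences escaping to the boundary -/

open Filter Topology in
/-- The gliding hump. If the functions `h k` have bounded derivatives, a common bound on
`v_log |h k '|`, and tend to zero locally uniformly, then sums of arbitrarily many suitably chosen
`h k` have bounded norm. Hence `T (h k)` can tend to no limit but zero. -/
lemma eq_zero_of_tendsto_of_escaping (T : Bloch vLog →L[ℂ] Bloch vLog) {h : ℕ → Bloch vLog}
    {M : ℝ} (hb : ∀ k, ∃ B, ∀ z, ‖discDeriv (h k).fn z‖ ≤ B)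
    (hM : ∀ k z, vLog z * ‖discDeriv (h k).fn z‖ ≤ M)
    (h0 : ∀ ε > 0, ∀ᶠ k in atTop, ‖(h k).fn 0‖ ≤ ε)
    (hc : ∀ ρ < 1, ∀ ε > 0, ∀ᶠ k in atTop, ∀ z : 𝔻, ‖(z : ℂ)‖ ≤ ρ →
      vLog z * ‖discDeriv (h k).fn z‖ ≤ ε)
    {y : Bloch vLog} (hy : Tendsto (fun k => T (h k)) atTop (𝓝 y)) : y = 0 := by
  have hM0 : 0 ≤ M := (mul_nonneg (vLog.pos 0).le (norm_nonneg _)).trans (hM 0 0)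
  -- sums `x` of `N` of the functions, with the bound `M + δ` not depending on `N`
  have key : ∀ N : ℕ, ∀ δ > 0, ∃ x : Bloch vLog, (∃ B, ∀ z, ‖discDeriv x.fn z‖ ≤ B) ∧
      (∀ z, vLog z * ‖discDeriv x.fn z‖ ≤ M + δ) ∧ ‖x.fn 0‖ ≤ δ ∧ ‖T x - N • y‖ ≤ δ := by
    intro N
    induction N with
    | zero =>
      intro δ hδ
      have hd : discDeriv (0 : Bloch vLog).fn = 0 := discDeriv_zero
      refine ⟨0, ⟨0, fun z => by simp [hd]⟩, fun z => ?_, ?_, ?_⟩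
      · simp only [hd, Pi.zero_apply, norm_zero, mul_zero]
        positivity
      · simpa [Bloch.fn_zero] using hδ.le
      · simpa using hδ.le
    | succ N ih =>
      intro δ hδ
      obtain ⟨x, ⟨B, hB⟩, hx, hx0, hxT⟩ := ih (δ / 2) (by positivity)
      have hB0 : 0 ≤ B := (norm_nonneg _).trans (hB 0)
      -- `x` is negligible for `|z| > ρ`, and the next function `h k` is chosen to be negligible
      -- for `|z| ≤ ρ`
      obtain ⟨ρ, hρ, hv⟩ := exists_vLog_le (ε := δ / 2 / (B + 1)) (by positivity)
      obtain ⟨k, hk1, hk2, hk3⟩ := ((hc ρ hρ (δ / 2) (by positivity)).and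
        ((h0 (δ / 2) (by positivity)).and
          (Metric.tendsto_nhds.1 hy (δ / 2) (by positivity)))).exists
      obtain ⟨B', hB'⟩ := hb k
      have hd : ∀ z, ‖discDeriv (x + h k).fn z‖ ≤
          ‖discDeriv x.fn z‖ + ‖discDeriv (h k).fn z‖ := fun z => by
        rw [Bloch.fn_add, discDeriv_add x.isHolo (h k).isHolo]
        exact norm_add_le _ _
      refine ⟨x + h k, ⟨B + B', fun z => (hd z).trans (add_le_add (hB z) (hB' z))⟩,
        fun z => ?_, ?_, ?_⟩
      · have hvz := (vLog.pos z).le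
        refine (mul_le_mul_of_nonneg_left (hd z) hvz).trans ?_
        rw [mul_add]
        rcases le_or_gt ‖(z : ℂ)‖ ρ with hz | hz
        · linarith [hx z, hk1 z hz]
        · have h2 : vLog z * ‖discDeriv x.fn z‖ ≤ δ / 2 := by
            have h3 := hv z hz
            rw [le_div_iff₀ (by positivity)] at h3
            have := hB z
            nlinarith
          linarith [hM k z]
      · rw [Bloch.fn_add]
        refine (norm_add_le _ _).trans ?_
        linarith
      · rw [dist_eq_norm] at hk3
        have e : T (x + h k) - (N + 1) • y = (T x - N • y) + (T (h k) - y) := by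
          rw [map_add, succ_nsmul]; abel
        rw [e]
        refine (norm_add_le _ _).trans ?_
        linarith
  by_contra hy0
  have hy1 : 0 < ‖y‖ := norm_pos_iff.2 hy0
  obtain ⟨N, hN⟩ := exists_nat_gt ((‖T‖ * (M + 2) + 1) / ‖y‖)
  rw [div_lt_iff₀ hy1] at hN
  obtain ⟨x, -, hx, hx0, hxT⟩ := key N 1 one_pos
  have h1 : ‖x‖ ≤ M + 2 := (Bloch.norm_le hx).trans (by linarith)
  have h2 := T.le_opNorm_of_le h1
  have h3 : ‖N • y‖ ≤ ‖T x‖ + ‖T x - N • y‖ := by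
    have := norm_sub_le (T x) (T x - N • y)
    rwa [sub_sub_cancel] at this
  rw [← Nat.cast_smul_eq_nsmul ℂ, norm_smul, Complex.norm_natCast,
    Nat.cast_smul_eq_nsmul ℂ] at h3
  linarith

open Filter Topology in
/-- A compact operator maps a sequence that escapes to the boundary to a null sequence. -/
lemma tendsto_zero_of_isCompactOperator {T : Bloch vLog →L[ℂ] Bloch vLog}
    (hT : IsCompactOperator T) {h : ℕ → Bloch vLog}
    {M : ℝ} (hb : ∀ k, ∃ B, ∀ z, ‖discDeriv (h k).fn z‖ ≤ B)
    (hM : ∀ k z, vLog z * ‖discDeriv (h k).fn z‖ ≤ M)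
    {M₀ : ℝ} (hM₀ : ∀ k, ‖(h k).fn 0‖ ≤ M₀)
    (h0 : ∀ ε > 0, ∀ᶠ k in atTop, ‖(h k).fn 0‖ ≤ ε)
    (hc : ∀ ρ < 1, ∀ ε > 0, ∀ᶠ k in atTop, ∀ z : 𝔻, ‖(z : ℂ)‖ ≤ ρ →
      vLog z * ‖discDeriv (h k).fn z‖ ≤ ε) : Tendsto (fun k => T (h k)) atTop (𝓝 0) := by
  refine tendsto_of_subseq_tendsto fun ns hns => ?_
  obtain ⟨C, hC, hsub⟩ := IsCompactOperator.image_closedBall_subset_compact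
    (f := (T : Bloch vLog →ₗ[ℂ] Bloch vLog)) hT (M₀ + M)
  obtain ⟨y, -, ms, hms, hy⟩ := hC.tendsto_subseq (x := fun k => T (h (ns k))) fun k =>
    hsub ⟨h (ns k), by
      rw [mem_closedBall_zero_iff]
      exact (Bloch.norm_le (hM _)).trans (by linarith [hM₀ (ns k)]), rfl⟩
  have ht : Tendsto (ns ∘ ms) atTop atTop := hns.comp hms.tendsto_atTop
  have hy0 : y = 0 := eq_zero_of_tendsto_of_escaping T (h := h ∘ ns ∘ ms) (M := M)
    (fun k => hb _) (fun k => hM _) (fun ε hε => ht.eventually (h0 ε hε))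
    (fun ρ hρ ε hε => ht.eventually (hc ρ hρ ε hε)) hy
  exact ⟨ms, hy0 ▸ hy⟩

/-- The test function as an element of the Bloch-type space. -/
def testBloch {α β : ℝ} (hα : |α| ≤ 3) (hβ : |β| ≤ 3) (a : 𝔻) : Bloch vLog :=
  Bloch.ofBound (testFn α β a) (isHolo_testFn α β a).1 30000
    (vLog_mul_norm_deriv_testFn_le hα hβ a)

lemma norm_testBloch_le {α β : ℝ} (hα : |α| ≤ 3) (hβ : |β| ≤ 3) (a : 𝔻) :
    ‖testBloch hα hβ a‖ ≤ 600000 := by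
  refine (Bloch.norm_le (vLog_mul_norm_deriv_testFn_le hα hβ a)).trans ?_
  have h1 := norm_testFn_zero_le hα hβ a
  have h2 : wLog a ≤ 4 := by
    have := quarter_le_loglog_four.trans (loglog_le a)
    rw [wLog_apply, inv_le_comm₀ (by linarith) (by norm_num)]
    linarith
  change ‖testFn α β a 0‖ + 30000 ≤ _
  linarith

open Filter Topology in
/-- A compact operator maps the test functions to a null sequence as their base points tend to the
boundary. -/
lemma tendsto_compact_testBloch {T : Bloch vLog →L[ℂ] Bloch vLog} (hT : IsCompactOperator T)
    {α β : ℝ} (hα : |α| ≤ 3) (hβ : |β| ≤ 3) {a : ℕ → 𝔻}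
    (ha : Tendsto (fun k => ‖(a k : ℂ)‖) atTop (𝓝 1)) :
    Tendsto (fun k => T (testBloch hα hβ (a k))) atTop (𝓝 0) := by
  have hw : ∀ ε > 0, ∀ᶠ k in atTop, wLog (a k) ≤ ε := fun ε hε => by
    obtain ⟨ρ, hρ, h⟩ := exists_wLog_le hε
    filter_upwards [ha.eventually_const_lt hρ] with k hk using h _ hk
  refine tendsto_zero_of_isCompactOperator hT (M := 30000) (M₀ := 600000)
    (fun k => ⟨_, norm_deriv_testFn_le' hα hβ (a k)⟩)
    (fun k => vLog_mul_norm_deriv_testFn_le hα hβ (a k))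
    (fun k => (Bloch.norm_apply_zero_le _).trans (norm_testBloch_le hα hβ (a k)))
    (fun ε hε => ?_) fun ρ hρ ε hε => ?_
  · filter_upwards [hw (ε / 120000) (by positivity)] with k hk
    refine (norm_testFn_zero_le hα hβ (a k)).trans ?_
    linarith
  · rcases lt_or_ge ρ 0 with hρ0 | hρ0
    · exact Eventually.of_forall fun k z hz => absurd (hz.trans_lt hρ0) (norm_nonneg _).not_gt
    -- on `|z| ≤ ρ` the weight `w_log` is bounded below by its value at the point `ρ`
    set r : 𝔻 := Complex.UnitDisc.mk (ρ : ℂ)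
      (by rwa [Complex.norm_real, Real.norm_of_nonneg hρ0]) with hr
    have hwr := wLog.pos r
    filter_upwards [hw (ε * wLog r / 30000) (by positivity)] with k hk z hz
    refine (vLog_mul_norm_deriv_testFn_le' hα hβ (a k) z).trans ?_
    have h1 : wLog r ≤ wLog z := wLog_le_of_norm_le (by
      rwa [hr, Complex.UnitDisc.coe_mk, Complex.norm_real, Real.norm_of_nonneg hρ0])
    have h2 : wLog (a k) / wLog z ≤ wLog (a k) / wLog r := by
      have := (wLog.pos (a k)).le
      gcongr
    have h3 : wLog (a k) / wLog r ≤ ε / 30000 := by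
      rw [div_le_iff₀ hwr]
      linarith
    linarith

/-! ### Lower bounds for the essential norm -/

open Filter Topology in
/-- If the values of `S` on test functions based at `φ z` dominate a quantity `Q z`, then `Q z` is
controlled near the boundary by the distance from `S` to any compact operator. -/
lemma exists_le_of_isCompactOperator {φ : 𝔻 → 𝔻} {S T : Bloch vLog →L[ℂ] Bloch vLog}
    (hT : IsCompactOperator T) {α β : ℝ} (hα : |α| ≤ 3) (hβ : |β| ≤ 3) {Q : 𝔻 → ℝ}
    (hQ : ∀ z, 1 / 2 ≤ ‖(φ z : ℂ)‖ →
      Q z ≤ vLog z * ‖discDeriv (S (testBloch hα hβ (φ z))).fn z‖)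
    {δ : ℝ} (hδ : 0 < δ) :
    ∃ ρ < 1, ∀ z, ρ < ‖(φ z : ℂ)‖ → Q z ≤ 600000 * ‖S - T‖ + δ := by
  by_contra! hcon
  have hlt : ∀ k : ℕ, (1 : ℝ) - 1 / (k + 2) < 1 := fun k => by
    have : (0 : ℝ) < 1 / (k + 2) := by positivity
    linarith
  choose z hz1 hz2 using fun k : ℕ => hcon _ (hlt k)
  have ha : Tendsto (fun k => ‖(φ (z k) : ℂ)‖) atTop (𝓝 1) := by
    have h1 : Tendsto (fun k : ℕ => (1 : ℝ) - 1 / (k + 2)) atTop (𝓝 1) := by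
      have := (tendsto_one_div_add_atTop_nhds_zero_nat (𝕜 := ℝ)).comp (tendsto_add_atTop_nat 1)
      refine (this.const_sub 1).congr' (.of_forall fun k => ?_) |>.trans (by simp)
      simp only [Function.comp_apply]
      push_cast
      ring
    exact tendsto_of_tendsto_of_tendsto_of_le_of_le h1 tendsto_const_nhds
      (fun k => (hz1 k).le) fun k => (φ (z k)).norm_lt_one.le
  have hK := tendsto_compact_testBloch hT hα hβ ha
  obtain ⟨k, hk⟩ := (Metric.tendsto_nhds.1 hK δ hδ).exists
  rw [dist_zero_right] at hk
  set g := testBloch hα hβ (φ (z k)) with hg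
  have h2 : (1 / 2 : ℝ) ≤ ‖(φ (z k) : ℂ)‖ := by
    refine le_trans ?_ (hz1 k).le
    have : (1 : ℝ) / (k + 2) ≤ 1 / 2 := by
      gcongr
      have := k.cast_nonneg (α := ℝ)
      linarith
    linarith
  have h3 := (hQ _ h2).trans ((S g).weight_mul_norm_deriv_le (z k))
  have h4 : ‖S g‖ ≤ ‖(S - T) g‖ + ‖T g‖ := by
    have := norm_add_le ((S - T) g) (T g)
    rwa [sub_apply, sub_add_cancel] at this
  have h5 := (S - T).le_opNorm_of_le (norm_testBloch_le hα hβ (φ (z k)))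
  linarith [hz2 k]

section Lower

variable {φ : 𝔻 → 𝔻} (hφ : IsHolo fun z => (φ z : ℂ)) {S : Bloch vLog →L[ℂ] Bloch vLog}
  (hS : ∀ f : Bloch vLog, (S f).fn = weightedCompOp (discDeriv fun z => (φ z : ℂ)) φ f.fn)

include hφ hS

lemma discDeriv_weightedCompOp_bloch (f : Bloch vLog) (z : 𝔻) : discDeriv (S f).fn z =
    discDeriv (discDeriv fun z => (φ z : ℂ)) z * f.fn (φ z) +
      discDeriv (fun z => (φ z : ℂ)) z ^ 2 * discDeriv f.fn (φ z) := by
  rw [hS, (isHolo_weightedCompOp hφ hφ.discDeriv f.isHolo).2]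
  ring

/-- Test functions whose derivative vanishes at the base point detect the second derivative of the
symbol. -/
lemma exists_second_deriv_le {T : Bloch vLog →L[ℂ] Bloch vLog} (hT : IsCompactOperator T)
    {δ : ℝ} (hδ : 0 < δ) : ∃ ρ < 1, ∀ z, ρ < ‖(φ z : ℂ)‖ →
      vLog z * ‖discDeriv (discDeriv fun z => (φ z : ℂ)) z‖ / wLog (φ z) ≤
        600000 * ‖S - T‖ + δ := by
  -- with `α = 3`, `β = -2` the test function has value `1 / w_log(a)` and derivative `0` at `a`
  have hα : |(3 : ℝ)| ≤ 3 := by norm_num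
  have hβ : |(-2 : ℝ)| ≤ 3 := by norm_num
  refine exists_le_of_isCompactOperator hT hα hβ (fun z _ => le_of_eq ?_) hδ
  rw [discDeriv_weightedCompOp_bloch hφ hS]
  change _ = vLog z * ‖_ * testFn 3 (-2) (φ z) (φ z) + _ * discDeriv (testFn 3 (-2) (φ z)) (φ z)‖
  rw [testFn_self, discDeriv_testFn_self]
  have hw := (wLog.pos (φ z)).le
  norm_num
  rw [abs_of_nonneg hw]
  ring

/-- Test functions that vanish at the base point detect the first derivative of the symbol. -/
lemma exists_deriv_sq_le {T : Bloch vLog →L[ℂ] Bloch vLog} (hT : IsCompactOperator T)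
    {δ : ℝ} (hδ : 0 < δ) : ∃ ρ < 1, ∀ z, ρ < ‖(φ z : ℂ)‖ →
      vLog z * ‖discDeriv (fun z => (φ z : ℂ)) z‖ ^ 2 / (8 * vLog (φ z)) ≤
        600000 * ‖S - T‖ + δ := by
  -- with `α = -1`, `β = 1` the test function has value `0` and derivative of order
  -- `1 / v_log(a)` at `a`
  have hα : |(-1 : ℝ)| ≤ 3 := by norm_num
  have hβ : |(1 : ℝ)| ≤ 3 := by norm_num
  refine exists_le_of_isCompactOperator hT hα hβ (fun z hz => ?_) hδ
  rw [discDeriv_weightedCompOp_bloch hφ hS]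
  change _ ≤ vLog z * ‖_ * testFn (-1) 1 (φ z) (φ z) + _ * discDeriv (testFn (-1) 1 (φ z)) (φ z)‖
  rw [testFn_self, discDeriv_testFn_self]
  have h1 := one_le_vLog_mul_norm_deriv_logLog (φ z) hz
  have hv := vLog.pos (φ z)
  have hvz := (vLog.pos z).le
  norm_num
  rw [div_le_iff₀ (by positivity)]
  have : 0 ≤ vLog z * ‖discDeriv (fun z => (φ z : ℂ)) z‖ ^ 2 := by positivity
  nlinarith

end Lower

/-! ### Finite-rank approximation of the identity -/

/-- The Taylor coefficients at the origin of a function on the disc. -/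
def coeff (n : ℕ) (f : 𝔻 → ℂ) : ℂ := (n.factorial : ℂ)⁻¹ * iteratedDeriv n (zeroExt f) 0

lemma IsHolo.contDiffAt_zero {f : 𝔻 → ℂ} (hf : IsHolo f) (n : ℕ) :
    ContDiffAt ℂ n (zeroExt f) 0 :=
  (DifferentiableOn.analyticAt hf (Metric.isOpen_ball.mem_nhds (by simp))).contDiffAt

lemma coeff_add (n : ℕ) {f g : 𝔻 → ℂ} (hf : IsHolo f) (hg : IsHolo g) :
    coeff n (f + g) = coeff n f + coeff n g := by
  have h := (zeroExt_add_eqOn f g).eventuallyEq_of_mem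
    (Metric.isOpen_ball.mem_nhds (show (0 : ℂ) ∈ Metric.ball 0 1 by simp))
  rw [coeff, h.iteratedDeriv_eq n, iteratedDeriv_add (hf.contDiffAt_zero n) (hg.contDiffAt_zero n),
    mul_add]
  rfl

lemma coeff_smul (n : ℕ) (c : ℂ) {f : 𝔻 → ℂ} (hf : IsHolo f) :
    coeff n (c • f) = c • coeff n f := by
  have h := (zeroExt_smul_eqOn c f).eventuallyEq_of_mem
    (Metric.isOpen_ball.mem_nhds (show (0 : ℂ) ∈ Metric.ball 0 1 by simp))
  rw [coeff, h.iteratedDeriv_eq n, iteratedDeriv_const_smul (hf.contDiffAt_zero n), coeff,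
    smul_eq_mul, smul_eq_mul]
  ring

lemma hasSum_coeff {f : 𝔻 → ℂ} (hf : IsHolo f) (z : 𝔻) :
    HasSum (fun n => coeff n f * (z : ℂ) ^ n) (f z) := by
  have h := Complex.hasSum_taylorSeries_on_ball hf (coe_mem z)
  rw [zeroExt_coe] at h
  refine h.congr_fun fun n => ?_
  rw [coeff, smul_eq_mul, smul_eq_mul, sub_zero]
  ring

/-- Cauchy's estimate on the circle of radius `(n + 1) / (n + 2)`. -/
lemma norm_coeff_le {f : 𝔻 → ℂ} (hf : IsHolo f) {M : ℝ} (hM : ∀ z, vLog z * ‖f z‖ ≤ M) (n : ℕ) :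
    ‖coeff n f‖ ≤ 6 * (n + 2) * M := by
  have hM0 : 0 ≤ M := (mul_nonneg (vLog.pos 0).le (norm_nonneg _)).trans (hM 0)
  set R : ℝ := (n + 1) / (n + 2) with hR
  have hR0 : 0 < R := by positivity
  have hR1 : R < 1 := by rw [hR, div_lt_one (by positivity)]; linarith
  have hd : DiffContOnCl ℂ (zeroExt f) (Metric.ball 0 R) := by
    refine DifferentiableOn.diffContOnCl (hf.mono ?_)
    rw [closure_ball _ hR0.ne']
    exact Metric.closedBall_subset_ball hR1
  have hC : ∀ z ∈ Metric.sphere (0 : ℂ) R, ‖zeroExt f z‖ ≤ 2 * (n + 2) * M := fun z hz => by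
    rw [mem_sphere_zero_iff_norm] at hz
    have hz1 : ‖z‖ < 1 := hz ▸ hR1
    rw [zeroExt_of_mem f (mem_ball_zero_iff.2 hz1)]
    set ζ := Complex.UnitDisc.mk z hz1
    have h1 := half_one_sub_le_vLog ζ
    have h2 : (1 - ‖(ζ : ℂ)‖) / 2 = 1 / (2 * (n + 2)) := by
      rw [Complex.UnitDisc.coe_mk, hz, hR]
      field_simp
      ring
    rw [h2] at h1
    have h3 : 1 / (2 * ((n : ℝ) + 2)) * ‖f ζ‖ ≤ M :=
      (mul_le_mul_of_nonneg_right h1 (norm_nonneg _)).trans (hM ζ)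
    rw [div_mul_eq_mul_div, one_mul, div_le_iff₀ (by positivity)] at h3
    linarith
  have h := Complex.norm_iteratedDeriv_le_of_forall_mem_sphere_norm_le n hR0 hd hC
  -- `1 / R ^ n = (1 + 1 / (n + 1)) ^ n` is at most `e`
  have hexp : 1 / R ^ n ≤ 3 := by
    have h1 : 1 / R = 1 / (n + 1) + 1 := by rw [hR]; field_simp; ring
    calc 1 / R ^ n = (1 / R) ^ n := by rw [one_div_pow]
      _ ≤ Real.exp (1 / (n + 1)) ^ n := by
        rw [h1]
        gcongr
        exact Real.add_one_le_exp _
      _ = Real.exp (n / (n + 1)) := by rw [← Real.exp_nat_mul]; congr 1; ring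
      _ ≤ Real.exp 1 := by
        gcongr
        rw [div_le_one (by positivity)]
        linarith
      _ ≤ 3 := Real.exp_one_lt_d9.le.trans (by norm_num)
  rw [coeff, norm_mul, norm_inv, Complex.norm_natCast]
  have hn : (0 : ℝ) < n.factorial := by exact_mod_cast n.factorial_pos
  calc _ ≤ (n.factorial : ℝ)⁻¹ * (n.factorial * (2 * (n + 2) * M) / R ^ n) := by gcongr
    _ = (2 * (n + 2) * M) * (1 / R ^ n) := by field_simp
    _ ≤ (2 * (n + 2) * M) * 3 := by gcongr
    _ = _ := by ring

/-- Differentiation as a linear map on the Bloch-type space. -/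
def Bloch.derivₗ (v : Weight) : Bloch v →ₗ[ℂ] 𝔻 → ℂ where
  toFun f := discDeriv f.fn
  map_add' f g := discDeriv_add f.isHolo g.isHolo
  map_smul' c f := discDeriv_smul c f.isHolo

/-- Evaluation at the origin. -/
def Bloch.evalZero (v : Weight) : Bloch v →L[ℂ] ℂ :=
  LinearMap.mkContinuous
    { toFun := fun f : Bloch v => f.fn 0
      map_add' := fun _ _ => rfl
      map_smul' := fun _ _ => rfl } 1 fun f => by
    rw [one_mul]
    exact f.norm_apply_zero_le

lemma Bloch.evalZero_apply {v : Weight} (f : Bloch v) : Bloch.evalZero v f = f.fn 0 := rfl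

/-- The Taylor coefficients of the derivative. -/
def Bloch.derivCoeff (n : ℕ) : Bloch vLog →L[ℂ] ℂ :=
  LinearMap.mkContinuous
    { toFun := fun f : Bloch vLog => coeff n (discDeriv f.fn)
      map_add' := fun f g => by
        rw [Bloch.fn_add, discDeriv_add f.isHolo g.isHolo,
          coeff_add n f.isHolo.discDeriv g.isHolo.discDeriv]
      map_smul' := fun c f => by
        rw [Bloch.fn_smul, discDeriv_smul c f.isHolo, coeff_smul n c f.isHolo.discDeriv]
        rfl } (6 * (n + 2)) fun f =>
    norm_coeff_le f.isHolo.discDeriv f.weight_mul_norm_deriv_le n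

lemma Bloch.derivCoeff_apply (n : ℕ) (f : Bloch vLog) :
    Bloch.derivCoeff n f = coeff n (discDeriv f.fn) := rfl

/-- The monomial `z ^ n` in the Bloch-type space of `v_log`. -/
def blochPow (n : ℕ) : Bloch vLog :=
  Bloch.ofBound (idPow n) (isHolo_idPow n).1 (3 * n) fun z => by
    rw [(isHolo_idPow n).2]
    have h1 : ‖(z : ℂ) ^ (n - 1)‖ ≤ 1 := by
      rw [norm_pow]
      exact pow_le_one₀ (norm_nonneg _) z.norm_lt_one.le
    have h2 := vLog_le_three z
    have h3 := vLog.pos z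
    simp only [Pi.smul_apply, smul_eq_mul, norm_mul, Complex.norm_natCast, idPow]
    gcongr
    exact mul_le_of_le_one_right n.cast_nonneg h1

/-- The operator that keeps the value at the origin and replaces the derivative `∑ d_n z ^ n` by
`∑_{n < N} r ^ n d_n z ^ n`. -/
def truncDilation (r : ℝ) (N : ℕ) : Bloch vLog →L[ℂ] Bloch vLog :=
  (Bloch.evalZero vLog).smulRight (blochPow 0) + ∑ n ∈ Finset.range N,
    (((r : ℂ) ^ n / (n + 1)) • Bloch.derivCoeff n).smulRight (blochPow (n + 1))

lemma isCompactOperator_smulRight {X Y : Type*} [NormedAddCommGroup X] [NormedSpace ℂ X]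
    [NormedAddCommGroup Y] [NormedSpace ℂ Y] (f : X →L[ℂ] ℂ) (y : Y) :
    IsCompactOperator (f.smulRight y) :=
  (isCompactOperator_of_locallyCompactSpace_dom f).clm_comp
    ((ContinuousLinearMap.id ℂ ℂ).smulRight y)

lemma isCompactOperator_truncDilation (r : ℝ) (N : ℕ) :
    IsCompactOperator (truncDilation r N) := by
  have : truncDilation r N ∈ compactOperator (RingHom.id ℂ) (Bloch vLog) (Bloch vLog) :=
    Submodule.add_mem _ (isCompactOperator_smulRight _ _)
      (Submodule.sum_mem _ fun n _ => isCompactOperator_smulRight _ _)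
  exact this

lemma truncDilation_apply (r : ℝ) (N : ℕ) (g : Bloch vLog) : truncDilation r N g =
    g.fn 0 • blochPow 0 + ∑ n ∈ Finset.range N,
      ((r : ℂ) ^ n / (n + 1) * coeff n (discDeriv g.fn)) • blochPow (n + 1) := by
  simp [truncDilation, Bloch.evalZero_apply, Bloch.derivCoeff_apply]

lemma truncDilation_zero (r : ℝ) (N : ℕ) (g : Bloch vLog) : (truncDilation r N g).fn 0 = g.fn 0 := by
  rw [← Bloch.evalZero_apply]
  have h : ∀ n, Bloch.evalZero vLog (blochPow n) = (0 : ℂ) ^ n := fun n => rfl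
  rw [truncDilation_apply, map_add, map_sum, map_smul, h]
  simp [h]

lemma discDeriv_truncDilation (r : ℝ) (N : ℕ) (g : Bloch vLog) (z : 𝔻) :
    discDeriv (truncDilation r N g).fn z =
      ∑ n ∈ Finset.range N, (r : ℂ) ^ n * coeff n (discDeriv g.fn) * (z : ℂ) ^ n := by
  change Bloch.derivₗ vLog (truncDilation r N g) z = _
  have h : ∀ n, Bloch.derivₗ vLog (blochPow n) = (n : ℂ) • idPow (n - 1) :=
    fun n => (isHolo_idPow n).2
  rw [truncDilation_apply, map_add, map_sum, map_smul, h]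
  simp only [map_smul, h, Pi.add_apply, Finset.sum_apply, Pi.smul_apply, smul_eq_mul, idPow,
    Nat.cast_zero, zero_mul, mul_zero, zero_add, Nat.add_sub_cancel]
  refine Finset.sum_congr rfl fun n _ => ?_
  have : (n : ℂ) + 1 ≠ 0 := by exact_mod_cast n.succ_ne_zero
  push_cast
  field_simp

lemma summable_add_two_mul_pow {x : ℝ} (h0 : 0 ≤ x) (h1 : x < 1) :
    Summable fun n : ℕ => 6 * ((n : ℝ) + 2) * x ^ n := by
  have hx : ‖x‖ < 1 := by rwa [Real.norm_of_nonneg h0]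
  have a1 := summable_pow_mul_geometric_of_norm_lt_one 1 hx
  have a0 := summable_pow_mul_geometric_of_norm_lt_one 0 hx
  refine ((a1.mul_left 6).add (a0.mul_left 12)).congr fun n => ?_
  ring

open Filter Topology in
/-- There are finite-rank operators `L` with `‖1 - L‖` bounded such that `1 - L` is small on any
given compact subset of the disc. -/
lemma exists_compact_approx {ρ : ℝ} (hρ : ρ < 1) {ε : ℝ} (hε : 0 < ε) :
    ∃ L : Bloch vLog →L[ℂ] Bloch vLog, IsCompactOperator L ∧ ∀ g : Bloch vLog,
      (g - L g).fn 0 = 0 ∧ (∀ z, vLog z * ‖discDeriv (g - L g).fn z‖ ≤ 5 * ‖g‖) ∧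
      ∀ z : 𝔻, ‖(z : ℂ)‖ ≤ ρ → ‖discDeriv (g - L g).fn z‖ ≤ ε * ‖g‖ := by
  wlog hρ0 : 0 ≤ ρ generalizing ρ
  · obtain ⟨L, h1, h2⟩ := this zero_lt_one le_rfl
    exact ⟨L, h1, fun g => ⟨(h2 g).1, (h2 g).2.1, fun z hz =>
      (h2 g).2.2 z (hz.trans (not_le.1 hρ0).le)⟩⟩
  -- the dilation factor `r`: on `|z| ≤ ρ` the dilation of `g'` is close to `g'`
  have hlim : Tendsto (fun r : ℝ => ∑' n : ℕ, 6 * ((n : ℝ) + 2) * ((1 - r ^ n) * ρ ^ n))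
      (𝓝[<] 1) (𝓝 (∑' n : ℕ, 6 * ((n : ℝ) + 2) * ((1 - 1 ^ n) * ρ ^ n))) := by
    refine tendsto_tsum_of_dominated_convergence (summable_add_two_mul_pow hρ0 hρ)
      (fun n => ?_) ?_
    · refine Tendsto.mono_left ?_ nhdsWithin_le_nhds
      have : Continuous fun r : ℝ => 6 * ((n : ℝ) + 2) * ((1 - r ^ n) * ρ ^ n) := by fun_prop
      exact this.tendsto 1
    · filter_upwards [Ioo_mem_nhdsLT (show (0 : ℝ) < 1 from one_pos)] with r hr n
      have h1 : r ^ n ≤ 1 := pow_le_one₀ hr.1.le hr.2.le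
      have h2 : 0 ≤ r ^ n := pow_nonneg hr.1.le n
      have h3 : 0 ≤ ρ ^ n := pow_nonneg hρ0 n
      rw [Real.norm_of_nonneg (by have := sub_nonneg.2 h1; positivity)]
      gcongr
      exact mul_le_of_le_one_left h3 (by linarith)
  simp only [one_pow, sub_self, zero_mul, mul_zero, tsum_zero] at hlim
  obtain ⟨r, hrε, hr0, hr1⟩ := ((hlim.eventually_lt_const (half_pos hε)).and
    (Ioo_mem_nhdsLT (show (0 : ℝ) < 1 from one_pos))).exists
  -- the degree `N`: the Taylor tail of the dilation is small, uniformly on the whole disc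
  have hsr := summable_add_two_mul_pow hr0.le hr1
  obtain ⟨N, hN⟩ := ((tendsto_sum_nat_add fun n : ℕ => 6 * ((n : ℝ) + 2) * r ^ n).eventually_lt_const
    (show 0 < min (1 / 3) (ε / 2) by positivity)).exists
  obtain ⟨hN1, hN2⟩ := lt_min_iff.1 hN
  refine ⟨truncDilation r N, isCompactOperator_truncDilation r N, fun g => ?_⟩
  have hg := g.isHolo.discDeriv
  have hc := norm_coeff_le hg g.weight_mul_norm_deriv_le
  set d : ℕ → ℂ := fun n => coeff n (discDeriv g.fn) with hd
  have hgn := norm_nonneg g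
  -- the dilated point
  have hrz : ∀ z : 𝔻, ‖(r : ℂ) * z‖ < 1 := fun z => norm_smul_coe_lt_one ⟨hr0.le, hr1.le⟩ z
  set δ : 𝔻 → 𝔻 := fun z => Complex.UnitDisc.mk _ (hrz z) with hδ
  have hdec : ∀ z, discDeriv (g - truncDilation r N g).fn z =
      (discDeriv g.fn z - discDeriv g.fn (δ z)) + (discDeriv g.fn (δ z) -
        ∑ n ∈ Finset.range N, d n * ((r : ℂ) * z) ^ n) := fun z => by
    rw [Bloch.fn_sub, discDeriv_sub g.isHolo (truncDilation r N g).isHolo, Pi.sub_apply,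
      discDeriv_truncDilation]
    have : ∑ n ∈ Finset.range N, d n * ((r : ℂ) * z) ^ n =
        ∑ n ∈ Finset.range N, (r : ℂ) ^ n * coeff n (discDeriv g.fn) * (z : ℂ) ^ n :=
      Finset.sum_congr rfl fun n _ => by rw [mul_pow, hd]; ring
    rw [this]
    ring
  have htail : ∀ z, ‖discDeriv g.fn (δ z) - ∑ n ∈ Finset.range N, d n * ((r : ℂ) * z) ^ n‖ ≤
      (∑' n : ℕ, 6 * (((n + N : ℕ) : ℝ) + 2) * r ^ (n + N)) * ‖g‖ := fun z => by
    refine ((hasSum_nat_add_iff' N).2 (hasSum_coeff hg (δ z))).norm_le_of_bounded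
      (((summable_nat_add_iff N).2 hsr).hasSum.mul_right ‖g‖) fun n => ?_
    have h1 : ‖((δ z : 𝔻) : ℂ)‖ ≤ r := by
      rw [hδ, Complex.UnitDisc.coe_mk, norm_mul, Complex.norm_real, Real.norm_of_nonneg hr0.le]
      exact mul_le_of_le_one_right hr0.le z.norm_lt_one.le
    rw [norm_mul, norm_pow]
    calc _ ≤ (6 * (((n + N : ℕ) : ℝ) + 2) * ‖g‖) * r ^ (n + N) := by
          gcongr
          exact hc _
      _ = _ := by ring
  refine ⟨?_, fun z => ?_, fun z hz => ?_⟩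
  · rw [Bloch.fn_sub, Pi.sub_apply, truncDilation_zero, sub_self]
  · have h1 : vLog z * ‖discDeriv g.fn (δ z)‖ ≤ 3 * ‖g‖ := by
      have h2 : vLog z ≤ 3 * vLog (δ z) := vLog_le_of_norm_le (by
        rw [hδ, Complex.UnitDisc.coe_mk, norm_mul, Complex.norm_real, Real.norm_of_nonneg hr0.le]
        exact mul_le_of_le_one_left (norm_nonneg _) hr1.le)
      have h3 := g.weight_mul_norm_deriv_le (δ z)
      have h4 := norm_nonneg (discDeriv g.fn (δ z))
      nlinarith
    have h2 := g.weight_mul_norm_deriv_le z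
    have h3 := htail z
    have h4 := vLog_le_three z
    have h5 := vLog.pos z
    rw [hdec]
    set A := discDeriv g.fn z
    set B := discDeriv g.fn (δ z)
    set C := B - ∑ n ∈ Finset.range N, d n * ((r : ℂ) * z) ^ n
    have h6 : ‖(A - B) + C‖ ≤ ‖A‖ + ‖B‖ + ‖C‖ :=
      (norm_add_le _ _).trans (by gcongr; exact norm_sub_le _ _)
    have h7 : ‖C‖ ≤ 1 / 3 * ‖g‖ := h3.trans (by gcongr)
    have h8 : vLog z * ‖C‖ ≤ 3 * (1 / 3 * ‖g‖) := by gcongr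
    calc vLog z * ‖(A - B) + C‖ ≤ vLog z * (‖A‖ + ‖B‖ + ‖C‖) := by gcongr
      _ = vLog z * ‖A‖ + vLog z * ‖B‖ + vLog z * ‖C‖ := by ring
      _ ≤ _ := by linarith
  · have h3 := htail z
    rw [hdec]
    have h1 : ‖discDeriv g.fn z - discDeriv g.fn (δ z)‖ ≤
        (∑' n : ℕ, 6 * ((n : ℝ) + 2) * ((1 - r ^ n) * ρ ^ n)) * ‖g‖ := by
      have hs : Summable fun n : ℕ => 6 * ((n : ℝ) + 2) * ((1 - r ^ n) * ρ ^ n) := by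
        refine Summable.of_nonneg_of_le (fun n => ?_) (fun n => ?_)
          (summable_add_two_mul_pow hρ0 hρ)
        · have := sub_nonneg.2 (pow_le_one₀ (n := n) hr0.le hr1.le)
          positivity
        · have h2 : 0 ≤ r ^ n := by positivity
          gcongr
          exact mul_le_of_le_one_left (by positivity) (by linarith)
      refine ((hasSum_coeff hg z).sub (hasSum_coeff hg (δ z))).norm_le_of_bounded
        (hs.hasSum.mul_right ‖g‖) fun n => ?_
      have e : coeff n (discDeriv g.fn) * (z : ℂ) ^ n -
          coeff n (discDeriv g.fn) * (δ z : ℂ) ^ n =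
          coeff n (discDeriv g.fn) * (((1 - r ^ n : ℝ) : ℂ) * (z : ℂ) ^ n) := by
        rw [hδ, Complex.UnitDisc.coe_mk, mul_pow]
        push_cast
        ring
      have h5 := sub_nonneg.2 (pow_le_one₀ (n := n) hr0.le hr1.le)
      rw [e, norm_mul, norm_mul, norm_pow, Complex.norm_real, Real.norm_of_nonneg h5]
      calc _ ≤ (6 * ((n : ℝ) + 2) * ‖g‖) * ((1 - r ^ n) * ρ ^ n) := by
            gcongr
            exact hc _
        _ = _ := by ring
    calc _ ≤ _ := norm_add_le _ _
      _ ≤ ε / 2 * ‖g‖ + ε / 2 * ‖g‖ := by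
        refine add_le_add (h1.trans (by gcongr)) (h3.trans (by gcongr))
      _ = ε * ‖g‖ := by ring

/-! ### Essential norms -/

section EssNorm

variable {X Y X' Y' : Type*} [NormedAddCommGroup X] [NormedSpace ℂ X] [NormedAddCommGroup Y]
  [NormedSpace ℂ Y] [NormedAddCommGroup X'] [NormedSpace ℂ X'] [NormedAddCommGroup Y']
  [NormedSpace ℂ Y']

lemma essNorm_le (T : X →L[ℂ] Y) {K : X →L[ℂ] Y} (hK : IsCompactOperator K) :
    essNorm T ≤ ‖T - K‖ :=
  csInf_le ⟨0, by rintro _ ⟨K, -, rfl⟩; exact norm_nonneg _⟩ ⟨K, hK, rfl⟩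

lemma exists_norm_sub_lt (T : X →L[ℂ] Y) {r : ℝ} (hr : essNorm T < r) :
    ∃ K : X →L[ℂ] Y, IsCompactOperator K ∧ ‖T - K‖ < r := by
  have hne : {r : ℝ | ∃ K : X →L[ℂ] Y, IsCompactOperator K ∧ r = ‖T - K‖}.Nonempty :=
    ⟨_, 0, isCompactOperator_zero, rfl⟩
  obtain ⟨_, ⟨K, hK, rfl⟩, h⟩ := exists_lt_of_csInf_lt hne hr
  exact ⟨K, hK, h⟩

lemma essNorm_nonneg (T : X →L[ℂ] Y) : 0 ≤ essNorm T :=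
  Real.sInf_nonneg (by rintro _ ⟨K, -, rfl⟩; exact norm_nonneg _)

lemma essNorm_comp_le (A : Y →L[ℂ] Y') (hA : ‖A‖ ≤ 1) (T : X →L[ℂ] Y) (B : X' →L[ℂ] X)
    (hB : ‖B‖ ≤ 1) : essNorm (A ∘L T ∘L B) ≤ essNorm T := by
  refine le_of_forall_gt_imp_ge_of_dense fun r hr => ?_
  obtain ⟨K, hK, h⟩ := exists_norm_sub_lt T hr
  have hc : IsCompactOperator (A ∘L K ∘L B) := (hK.comp_clm B).clm_comp A
  refine (essNorm_le _ hc).trans ?_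
  have e : A ∘L T ∘L B - A ∘L K ∘L B = A ∘L (T - K) ∘L B := by
    ext x
    simp
  rw [e]
  calc _ ≤ ‖A‖ * (‖T - K‖ * ‖B‖) := (A.opNorm_comp_le _).trans
        (mul_le_mul_of_nonneg_left ((T - K).opNorm_comp_le B) (norm_nonneg _))
    _ ≤ 1 * (‖T - K‖ * 1) := by gcongr
    _ ≤ r := by linarith

lemma essNorm_add_le_of_isCompactOperator (T : X →L[ℂ] Y) {R : X →L[ℂ] Y}
    (hR : IsCompactOperator R) : essNorm (T + R) ≤ essNorm T := by
  refine le_of_forall_gt_imp_ge_of_dense fun r hr => ?_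
  obtain ⟨K, hK, h⟩ := exists_norm_sub_lt T hr
  have hc : IsCompactOperator (K + R) := hK.add hR
  refine (essNorm_le _ hc).trans ?_
  rw [add_sub_add_right_eq_sub]
  exact h.le

end EssNorm

lemma zygmundENorm_primitive (v : Weight) {f : 𝔻 → ℂ} (hf : IsHolo f) :
    zygmundENorm v (primitive f) = blochENorm v f := by
  rw [zygmundENorm_eq, (isHolo_primitive hf).2, primitive_zero, enorm_zero, zero_add]

/-- Differentiation from the Zygmund-type space to the Bloch-type space. -/
def Zygmund.deriv (v : Weight) : Zygmund v →L[ℂ] Bloch v :=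
  LinearMap.mkContinuous
    { toFun := fun f : Zygmund v => (⟨discDeriv f.fn, f.isHolo.discDeriv, by
        have h := f.2.2
        rw [zygmundENorm_eq] at h
        exact le_add_self.trans_lt h⟩ : blochSubmodule v)
      map_add' := fun f g => Subtype.ext (discDeriv_add f.isHolo g.isHolo)
      map_smul' := fun c f => Subtype.ext (discDeriv_smul c f.isHolo) } 1 fun f => by
    rw [one_mul]
    refine ENNReal.toReal_mono f.2.2.ne ?_
    rw [zygmundENorm_eq]
    exact le_add_self

lemma Zygmund.deriv_fn {v : Weight} (f : Zygmund v) :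
    (Zygmund.deriv v f).fn = discDeriv f.fn := rfl

lemma primitive_add {f g : 𝔻 → ℂ} (hf : IsHolo f) (hg : IsHolo g) :
    primitive (f + g) = primitive f + primitive g := by
  have h1 := isHolo_primitive hf
  have h2 := isHolo_primitive hg
  funext z
  have h := primitive_discDeriv (h1.1.add h2.1) z
  rw [discDeriv_add h1.1 h2.1, h1.2, h2.2] at h
  simpa [primitive_zero] using h

lemma primitive_smul (c : ℂ) {f : 𝔻 → ℂ} (hf : IsHolo f) :
    primitive (c • f) = c • primitive f := by
  have h1 := isHolo_primitive hf
  funext z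
  have h := primitive_discDeriv (h1.1.smul c) z
  rw [discDeriv_smul c h1.1, h1.2] at h
  simpa [primitive_zero] using h

/-- Integration from the origin, from the Bloch-type space to the Zygmund-type space. -/
def Bloch.primitiveL (v : Weight) : Bloch v →L[ℂ] Zygmund v :=
  LinearMap.mkContinuous
    { toFun := fun f : Bloch v => (⟨primitive f.fn, (isHolo_primitive f.isHolo).1,
        (zygmundENorm_primitive v f.isHolo).trans_lt f.2.2⟩ : zygmundSubmodule v)
      map_add' := fun f g => Subtype.ext (primitive_add f.isHolo g.isHolo)
      map_smul' := fun c f => Subtype.ext (primitive_smul c f.isHolo) } 1 fun f => by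
    rw [one_mul]
    exact ENNReal.toReal_mono f.2.2.ne (zygmundENorm_primitive v f.isHolo).le

lemma Bloch.primitiveL_fn {v : Weight} (f : Bloch v) :
    (Bloch.primitiveL v f).fn = primitive f.fn := rfl

/-- The constant function `1` in the Zygmund-type space. -/
def Zygmund.one (v : Weight) : Zygmund v :=
  (⟨fun _ => 1, (isHolo_const 1).1, by
    rw [zygmundENorm, (isHolo_const 1).2, discDeriv_zero, growthENorm_zero]
    simp⟩ : zygmundSubmodule v)

lemma Zygmund.one_fn (v : Weight) : (Zygmund.one v).fn = fun _ => 1 := rfl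

/-- Evaluation at the origin. -/
def Zygmund.evalZero (v : Weight) : Zygmund v →L[ℂ] ℂ :=
  LinearMap.mkContinuous
    { toFun := fun f : Zygmund v => f.fn 0
      map_add' := fun _ _ => rfl
      map_smul' := fun _ _ => rfl } 1 fun f => by
    rw [one_mul, ← ENNReal.ofReal_le_ofReal_iff (norm_nonneg _), Zygmund.ofReal_norm,
      _root_.ofReal_norm, zygmundENorm_eq]
    exact le_self_add

lemma Zygmund.evalZero_apply {v : Weight} (f : Zygmund v) : Zygmund.evalZero v f = f.fn 0 := rfl

/-- Every function in the Zygmund-type space is the primitive of its derivative plus a constant. -/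
lemma Zygmund.eq_primitive_add {v : Weight} (f : Zygmund v) :
    f = Bloch.primitiveL v (Zygmund.deriv v f) + f.fn 0 • Zygmund.one v := by
  refine Zygmund.ext (funext fun z => ?_)
  rw [Zygmund.fn_add, Zygmund.fn_smul, Bloch.primitiveL_fn, Zygmund.deriv_fn, Zygmund.one_fn,
    Pi.add_apply, primitive_discDeriv f.isHolo]
  simp

/-- The space `Z^v` is `B^v` plus constants, and differentiation turns `C_φ` into `W_{φ',φ}`.
Since constants contribute an operator of finite rank, both operators have the same essential
norm. -/
lemma exists_weightedCompOp_essNorm_eq {v : Weight} {φ : 𝔻 → 𝔻} (hφ : IsHolo fun z => (φ z : ℂ))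
    (T : Zygmund v →L[ℂ] Zygmund v) (hT : ∀ f : Zygmund v, (T f).fn = compOp φ f.fn) :
    ∃ S : Bloch v →L[ℂ] Bloch v,
      (∀ f : Bloch v, (S f).fn = weightedCompOp (discDeriv fun z => (φ z : ℂ)) φ f.fn) ∧
        essNorm T = essNorm S := by
  have hD : ‖Zygmund.deriv v‖ ≤ 1 := LinearMap.mkContinuous_norm_le _ zero_le_one _
  have hP : ‖Bloch.primitiveL v‖ ≤ 1 := LinearMap.mkContinuous_norm_le _ zero_le_one _
  set S := Zygmund.deriv v ∘L T ∘L Bloch.primitiveL v with hS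
  have hT1 : T (Zygmund.one v) = Zygmund.one v := Zygmund.ext (by rw [hT]; rfl)
  have hD1 : Zygmund.deriv v (Zygmund.one v) = 0 := Bloch.ext (isHolo_const 1).2
  have hTS : T = Bloch.primitiveL v ∘L S ∘L Zygmund.deriv v +
      (Zygmund.evalZero v ∘L T).smulRight (Zygmund.one v) := by
    refine ContinuousLinearMap.ext fun f => ?_
    have h1 : Zygmund.deriv v (T f) = S (Zygmund.deriv v f) := by
      conv_lhs => rw [f.eq_primitive_add]
      rw [map_add, map_add, map_smul, map_smul, hT1, hD1, smul_zero, add_zero]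
      rfl
    conv_lhs => rw [(T f).eq_primitive_add, h1]
    rfl
  refine ⟨S, fun f => ?_, le_antisymm ?_ (essNorm_comp_le _ hD T _ hP)⟩
  · have h1 := isHolo_primitive f.isHolo
    have h2 : (S f).fn = discDeriv (T (Bloch.primitiveL v f)).fn := rfl
    rw [h2, hT, Bloch.primitiveL_fn, (isHolo_compOp hφ h1.1).2, h1.2]
  · calc essNorm T ≤ essNorm (Bloch.primitiveL v ∘L S ∘L Zygmund.deriv v) := by
          conv_lhs => rw [hTS]
          exact essNorm_add_le_of_isCompactOperator _ (isCompactOperator_smulRight _ _)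
      _ ≤ essNorm S := essNorm_comp_le _ hP S _ hD

/-! ### The norms of powers of the symbol -/

lemma zygmundENorm_primitive_primitive (v : Weight) {f : 𝔻 → ℂ} (hf : IsHolo f) :
    zygmundENorm v (primitive (primitive f)) = growthENorm v f := by
  have h := isHolo_primitive hf
  rw [zygmundENorm_primitive v h.1, blochENorm, h.2, primitive_zero, enorm_zero, zero_add]

lemma growthENorm_nat_smul (v : Weight) (n : ℕ) (f : 𝔻 → ℂ) :
    growthENorm v ((n : ℂ) • f) = n * growthENorm v f := by
  rw [growthENorm_smul, ← ofReal_norm, Complex.norm_natCast, ENNReal.ofReal_natCast]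

lemma zygmundENorm_opJ' (v : Weight) {φ : 𝔻 → 𝔻} (hφ : IsHolo fun z => (φ z : ℂ)) (n : ℕ) :
    zygmundENorm v (opJ' (discDeriv fun z => (φ z : ℂ)) (symbolPow φ n)) =
      growthENorm v (symbolPow φ n * discDeriv (discDeriv fun z => (φ z : ℂ))) :=
  zygmundENorm_primitive_primitive v (isHolo_mul (isHolo_symbolPow hφ n).1 hφ.discDeriv.discDeriv).1

lemma zygmundENorm_opI' (v : Weight) {φ : 𝔻 → 𝔻} (hφ : IsHolo fun z => (φ z : ℂ)) (n : ℕ) :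
    zygmundENorm v (opI' (discDeriv fun z => (φ z : ℂ)) (symbolPow φ (n + 1))) =
      ((n + 1 : ℕ) : ℝ≥0∞) *
        growthENorm v (symbolPow φ n * fun z => discDeriv (fun z => (φ z : ℂ)) z ^ 2) := by
  have h := isHolo_symbolPow hφ (n + 1)
  have e : discDeriv (symbolPow φ (n + 1)) * discDeriv (fun z => (φ z : ℂ)) =
      ((n + 1 : ℕ) : ℂ) • (symbolPow φ n * fun z => discDeriv (fun z => (φ z : ℂ)) z ^ 2) := by
    funext z
    rw [Pi.mul_apply, h.2]
    simp [symbolPow]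
    ring
  rw [← growthENorm_nat_smul, ← e]
  exact zygmundENorm_primitive_primitive v (isHolo_mul h.1.discDeriv hφ.discDeriv).1

lemma zygmundENorm_idPow (v : Weight) (n : ℕ) : zygmundENorm v (idPow (n + 2)) =
    ((n + 2 : ℕ) : ℝ≥0∞) * (((n + 1 : ℕ) : ℝ≥0∞) * growthENorm v (idPow n)) := by
  have h1 := (isHolo_idPow (n + 2)).2
  have h2 : discDeriv (discDeriv (idPow (n + 2))) =
      ((n + 2 : ℕ) : ℂ) • ((n + 1 : ℕ) : ℂ) • idPow n := by
    rw [h1, discDeriv_smul _ (isHolo_idPow _).1, (isHolo_idPow _).2]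
    rfl
  rw [zygmundENorm, h2, growthENorm_nat_smul, growthENorm_nat_smul, h1]
  simp [idPow]

open Filter in
/-- The two sequences in terms of weighted suprema of the derivatives of the symbol. -/
lemma powerQuantity_eq {φ : 𝔻 → 𝔻} (hφ : IsHolo fun z => (φ z : ℂ)) : powerQuantity φ =
    max (limsup (fun n => growthENorm vLog (symbolPow φ n *
        discDeriv (discDeriv fun z => (φ z : ℂ))) / growthENorm wLog (idPow n)) atTop)
      (limsup (fun n => growthENorm vLog (symbolPow φ n *
        fun z => discDeriv (fun z => (φ z : ℂ)) z ^ 2) / growthENorm vLog (idPow n)) atTop) := by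
  rw [powerQuantity]
  congr 1
  · congr 1
    funext n
    rw [zygmundENorm_opJ' vLog hφ, zygmundENorm_idPow, ← mul_assoc]
    push_cast
    rw [ENNReal.mul_div_mul_left _ _ (by positivity)
      (ENNReal.mul_ne_top (by finiteness) (by finiteness))]
  · rw [← limsup_nat_add _ 1]
    congr 1
    funext n
    rw [zygmundENorm_opI' vLog hφ, zygmundENorm_idPow]
    push_cast
    rw [add_assoc, one_add_one_eq_two,
      ENNReal.mul_div_mul_left _ _ (by positivity) (by finiteness),
      ENNReal.mul_div_mul_left _ _ (by positivity) (by finiteness)]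

/-! ### Power sequences and suprema near the boundary -/

lemma growthENorm_idPow_ne_top (w : Weight) (n : ℕ) : growthENorm w (idPow n) ≠ ∞ := by
  obtain ⟨C, hC⟩ := w.bounded
  refine ne_top_of_le_ne_top ENNReal.ofReal_ne_top (growthENorm_le_ofReal (B := C) fun z => ?_)
  have h : ‖idPow n z‖ ≤ 1 := by
    rw [idPow, norm_pow]
    exact pow_le_one₀ (norm_nonneg _) z.norm_lt_one.le
  have := w.pos z
  nlinarith [hC z]

lemma le_growthENorm_idPow (w : Weight) (n : ℕ) (z : 𝔻) :
    ENNReal.ofReal (w z * ‖(z : ℂ)‖ ^ n) ≤ growthENorm w (idPow n) := by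
  have := le_growthENorm w (idPow n) z
  rwa [idPow, norm_pow] at this

lemma growthENorm_idPow_ne_zero (w : Weight) (n : ℕ) : growthENorm w (idPow n) ≠ 0 := by
  intro h
  have h1 := le_growthENorm_idPow w n (Complex.UnitDisc.mk (1 / 2) (by norm_num))
  rw [h, nonpos_iff_eq_zero, ENNReal.ofReal_eq_zero, Complex.UnitDisc.coe_mk] at h1
  have h2 := w.pos (Complex.UnitDisc.mk (1 / 2) (by norm_num))
  have : 0 < ‖(1 / 2 : ℂ)‖ ^ n := by norm_num
  exact absurd h1 (not_le.2 (mul_pos h2 this))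

section Powers

variable {φ : 𝔻 → 𝔻} {w : Weight} {Q : 𝔻 → ℂ}

lemma vLog_mul_norm_symbolPow_mul (n : ℕ) (z : 𝔻) : vLog z * ‖(symbolPow φ n * Q) z‖ =
    vLog z * ‖Q z‖ * ‖(φ z : ℂ)‖ ^ n := by
  rw [Pi.mul_apply, norm_mul, symbolPow, norm_pow]
  ring

open Filter Topology in
/-- Where `φ` stays away from the boundary, `φ ^ n` decays faster than the norm of `z ^ n`; so only
the values near the boundary count. -/
lemma limsup_growthENorm_div_le {C₀ : ℝ} (hC₀ : ∀ z, vLog z * ‖Q z‖ ≤ C₀) {ρ : ℝ} (hρ : ρ < 1)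
    {c : ℝ} (hc : 0 ≤ c) (h : ∀ z, ρ < ‖(φ z : ℂ)‖ → vLog z * ‖Q z‖ ≤ c * w (φ z))
    {δ : ℝ} (hδ : 0 < δ) :
    limsup (fun n => growthENorm vLog (symbolPow φ n * Q) / growthENorm w (idPow n)) atTop ≤
      ENNReal.ofReal (c + δ) := by
  have hC₀0 : 0 ≤ C₀ := (mul_nonneg (vLog.pos 0).le (norm_nonneg _)).trans (hC₀ 0)
  set ρ₀ := max ρ 0 with hρ₀
  have hρ₀0 : 0 ≤ ρ₀ := le_max_right _ _
  have hρ₀1 : ρ₀ < 1 := max_lt hρ one_pos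
  -- a point of the disc with modulus strictly between `ρ₀` and `1`
  obtain ⟨p, hp0, hp1⟩ := exists_between hρ₀1
  have hpn : ‖(p : ℂ)‖ = p := by
    rw [Complex.norm_real, Real.norm_of_nonneg (hρ₀0.trans hp0.le)]
  set ζ : 𝔻 := Complex.UnitDisc.mk (p : ℂ) (by rwa [hpn])
  have hw := w.pos ζ
  have hp : 0 < p := hρ₀0.trans_lt hp0
  have hlim : Tendsto (fun n : ℕ => C₀ * (ρ₀ / p) ^ n) atTop (𝓝 0) := by
    have := tendsto_pow_atTop_nhds_zero_of_lt_one (div_nonneg hρ₀0 hp.le)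
      ((div_lt_one hp).2 hp0)
    simpa using this.const_mul C₀
  refine limsup_le_of_le (by isBoundedDefault) ?_
  filter_upwards [hlim.eventually_lt_const (mul_pos hδ hw)] with n hn
  rw [ENNReal.div_le_iff (growthENorm_idPow_ne_zero w n) (growthENorm_idPow_ne_top w n)]
  refine iSup_le fun z => ?_
  rw [ofReal_mul_enorm, vLog_mul_norm_symbolPow_mul]
  rcases le_or_gt ‖(φ z : ℂ)‖ ρ₀ with hz | hz
  · have h1 : C₀ * ρ₀ ^ n ≤ δ * (w ζ * ‖(ζ : ℂ)‖ ^ n) := by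
      rw [div_pow, ← mul_div_assoc, div_lt_iff₀ (by positivity)] at hn
      rw [Complex.UnitDisc.coe_mk, hpn]
      linarith
    calc _ ≤ ENNReal.ofReal (δ * (w ζ * ‖(ζ : ℂ)‖ ^ n)) := by
          refine ENNReal.ofReal_le_ofReal (le_trans ?_ h1)
          gcongr
          exact hC₀ z
      _ = ENNReal.ofReal δ * ENNReal.ofReal (w ζ * ‖(ζ : ℂ)‖ ^ n) := ENNReal.ofReal_mul hδ.le
      _ ≤ _ := by
        gcongr
        · linarith
        · exact le_growthENorm_idPow w n ζ
  · calc _ ≤ ENNReal.ofReal (c * (w (φ z) * ‖(φ z : ℂ)‖ ^ n)) := by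
          refine ENNReal.ofReal_le_ofReal ?_
          rw [← mul_assoc]
          exact mul_le_mul_of_nonneg_right (h z ((le_max_left _ _).trans_lt hz)) (by positivity)
      _ = ENNReal.ofReal c * ENNReal.ofReal (w (φ z) * ‖(φ z : ℂ)‖ ^ n) := ENNReal.ofReal_mul hc
      _ ≤ _ := by
        gcongr
        · linarith
        · exact le_growthENorm_idPow w n (φ z)

open Filter in
/-- Since some `z ^ n` is almost extremal at `φ z`, the power sequence controls `Q` near the
boundary. -/
lemma exists_le_of_limsup_growthENorm_div_lt
    (hw : ∀ N : ℕ, ∃ ρ < 1, ∀ z : 𝔻, ρ < ‖(z : ℂ)‖ → ∃ n ≥ N, ∀ s : 𝔻,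
      w s * ‖(s : ℂ)‖ ^ n ≤ 80 * (w z * ‖(z : ℂ)‖ ^ n)) {m : ℝ} (hm0 : 0 ≤ m)
    (hm : limsup (fun n => growthENorm vLog (symbolPow φ n * Q) / growthENorm w (idPow n)) atTop <
      ENNReal.ofReal m) :
    ∃ ρ < 1, ∀ z, ρ < ‖(φ z : ℂ)‖ → vLog z * ‖Q z‖ ≤ 80 * m * w (φ z) := by
  obtain ⟨N, hN⟩ := eventually_atTop.1 (eventually_lt_of_limsup_lt hm)
  obtain ⟨ρ, hρ, h⟩ := hw N
  refine ⟨max ρ 0, max_lt hρ one_pos, fun z hz => ?_⟩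
  obtain ⟨hz1, hz0⟩ := max_lt_iff.1 hz
  obtain ⟨n, hn, hs⟩ := h (φ z) hz1
  have h1 := (hN n hn).le
  rw [ENNReal.div_le_iff (growthENorm_idPow_ne_zero w n) (growthENorm_idPow_ne_top w n)] at h1
  have h2 : growthENorm w (idPow n) ≤ ENNReal.ofReal (80 * (w (φ z) * ‖(φ z : ℂ)‖ ^ n)) :=
    growthENorm_le_ofReal fun s => by rw [idPow, norm_pow]; exact hs s
  have hwz := w.pos (φ z)
  have h3 := (le_growthENorm vLog (symbolPow φ n * Q) z).trans
    (h1.trans (mul_le_mul_right h2 _))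
  rw [vLog_mul_norm_symbolPow_mul, ← ENNReal.ofReal_mul hm0,
    ENNReal.ofReal_le_ofReal_iff (by positivity)] at h3
  have hpow : 0 < ‖(φ z : ℂ)‖ ^ n := pow_pos hz0 n
  refine le_of_mul_le_mul_right ?_ hpow
  linarith

end Powers

/-! ### Comparison with the essential norm -/

section Main

variable {φ : 𝔻 → 𝔻} (hφ : IsHolo fun z => (φ z : ℂ)) {S : Bloch vLog →L[ℂ] Bloch vLog}
  (hS : ∀ f : Bloch vLog, (S f).fn = weightedCompOp (discDeriv fun z => (φ z : ℂ)) φ f.fn)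

include hφ hS

lemma vLog_mul_second_deriv_le (z : 𝔻) :
    vLog z * ‖discDeriv (discDeriv fun z => (φ z : ℂ)) z‖ ≤ ‖S (blochPow 0)‖ := by
  have h := (S (blochPow 0)).weight_mul_norm_deriv_le z
  have h1 : (blochPow 0).fn (φ z) = 1 := pow_zero _
  have h2 : discDeriv (blochPow 0).fn (φ z) = 0 := by
    change discDeriv (idPow 0) (φ z) = 0
    simp [(isHolo_idPow 0).2]
  rwa [discDeriv_weightedCompOp_bloch hφ hS, h1, h2, mul_one, mul_zero, add_zero] at h

lemma vLog_mul_deriv_sq_le (z : 𝔻) :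
    vLog z * ‖discDeriv (fun z => (φ z : ℂ)) z ^ 2‖ ≤ ‖S (blochPow 1)‖ + ‖S (blochPow 0)‖ := by
  have h := (S (blochPow 1)).weight_mul_norm_deriv_le z
  have h1 : (blochPow 1).fn (φ z) = φ z := pow_one _
  have h2 : discDeriv (blochPow 1).fn (φ z) = 1 := by
    change discDeriv (idPow 1) (φ z) = 1
    simp [(isHolo_idPow 1).2, idPow]
  rw [discDeriv_weightedCompOp_bloch hφ hS, h1, h2, mul_one] at h
  have h3 := vLog_mul_second_deriv_le hφ hS z
  have hv := vLog.pos z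
  set A := discDeriv (discDeriv fun z => (φ z : ℂ)) z
  set B := discDeriv (fun z => (φ z : ℂ)) z ^ 2
  have h4 : ‖B‖ ≤ ‖A * φ z + B‖ + ‖A‖ := by
    have h5 := norm_sub_le (A * φ z + B) (A * φ z)
    rw [add_sub_cancel_left] at h5
    have h6 : ‖A * φ z‖ ≤ ‖A‖ := by
      rw [norm_mul]
      exact mul_le_of_le_one_right (norm_nonneg _) (φ z).norm_lt_one.le
    linarith
  nlinarith

lemma powerQuantity_le : powerQuantity φ ≤ 4800000 * ENNReal.ofReal (essNorm S) := by
  refine ENNReal.le_of_forall_pos_le_add fun ε hε _ => ?_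
  -- the bound below is `4800000 * essNorm S + 4800009 * δ`
  set δ : ℝ := ε / 4800009 with hδ
  have hδ0 : 0 < δ := div_pos (NNReal.coe_pos.2 hε) (by norm_num)
  obtain ⟨K, hK, hSK⟩ := exists_norm_sub_lt S (lt_add_of_pos_right _ hδ0)
  have he := essNorm_nonneg S
  obtain ⟨ρ₁, hρ₁, h₁⟩ := exists_second_deriv_le hφ hS hK hδ0
  obtain ⟨ρ₂, hρ₂, h₂⟩ := exists_deriv_sq_le hφ hS hK hδ0
  have hc : 0 ≤ 600000 * ‖S - K‖ + δ := by positivity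
  have hlast : ENNReal.ofReal (8 * (600000 * ‖S - K‖ + δ) + δ) ≤
      4800000 * ENNReal.ofReal (essNorm S) + ε := by
    have h1 : 8 * (600000 * ‖S - K‖ + δ) + δ ≤ 4800000 * essNorm S + ε := by
      have : (ε : ℝ) = 4800009 * δ := by rw [hδ]; field_simp
      rw [this]
      linarith
    refine (ENNReal.ofReal_le_ofReal h1).trans_eq ?_
    rw [ENNReal.ofReal_add (by positivity) ε.coe_nonneg, ENNReal.ofReal_mul (by norm_num),
      ENNReal.ofReal_coe_nnreal]
    norm_num
  rw [powerQuantity_eq hφ]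
  refine (max_le ?_ ?_).trans hlast
  · refine (limsup_growthENorm_div_le (vLog_mul_second_deriv_le hφ hS) hρ₁ hc (fun z hz => ?_)
      hδ0).trans (ENNReal.ofReal_le_ofReal (by linarith))
    exact (div_le_iff₀ (wLog.pos _)).1 (h₁ z hz)
  · refine limsup_growthENorm_div_le (vLog_mul_deriv_sq_le hφ hS) hρ₂ (by positivity)
      (fun z hz => ?_) hδ0
    have h := (div_le_iff₀ (mul_pos (by norm_num) (vLog.pos _))).1 (h₂ z hz)
    rw [norm_pow]
    linarith

/-- Composing `S` with the approximations of the identity leaves only the behaviour near the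
boundary, where the growth of Bloch-type functions is known. -/
lemma essNorm_le_of_near_boundary {m : ℝ} (hm : 0 ≤ m) {ρ : ℝ} (hρ : ρ < 1)
    (h₁ : ∀ z, ρ < ‖(φ z : ℂ)‖ →
      vLog z * ‖discDeriv (discDeriv fun z => (φ z : ℂ)) z‖ ≤ m * wLog (φ z))
    (h₂ : ∀ z, ρ < ‖(φ z : ℂ)‖ →
      vLog z * ‖discDeriv (fun z => (φ z : ℂ)) z ^ 2‖ ≤ m * vLog (φ z)) :
    essNorm S ≤ 20 * m := by
  set C₁ := ‖S (blochPow 0)‖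
  set C₂ := ‖S (blochPow 1)‖ + ‖S (blochPow 0)‖
  set C₀ := ‖discDeriv (fun z => (φ z : ℂ)) 0‖
  have hC : 0 < C₀ + C₁ + C₂ + 1 := by positivity
  refine le_of_forall_pos_le_add fun η hη => ?_
  set ε := η / (C₀ + C₁ + C₂ + 1) with hε
  have hε0 : 0 < ε := by positivity
  have hεC : ε * (C₀ + C₁ + C₂ + 1) = η := by rw [hε]; field_simp
  -- the radius also covers `φ 0`, so that the value of `S h` at the origin is small
  obtain ⟨L, hL, hLg⟩ := exists_compact_approx (max_lt hρ (φ 0).norm_lt_one) hε0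
  have hSL : IsCompactOperator (S ∘L L) := hL.clm_comp S
  refine (essNorm_le S hSL).trans ?_
  refine ContinuousLinearMap.opNorm_le_bound _ (by positivity) fun g => ?_
  obtain ⟨h0, hM, hsmall⟩ := hLg g
  have e : (S - S ∘L L) g = S (g - L g) := by simp
  rw [e]
  set h := g - L g
  have hg := norm_nonneg g
  have hval : ∀ z : 𝔻, ‖(z : ℂ)‖ ≤ max ρ ‖(φ 0 : ℂ)‖ → ‖h.fn z‖ ≤ ε * ‖g‖ := fun z hz => by
    have := norm_le_of_deriv_le h.isHolo h0 z (B := fun t => ε * ‖g‖ * t)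
      (B' := fun _ => ε * ‖g‖) (by simp)
      (fun t _ => by simpa using (hasDerivAt_id t).const_mul (ε * ‖g‖)) fun t ht ζ hζ => by
        have hζz : ‖(ζ : ℂ)‖ ≤ ‖(z : ℂ)‖ := by
          rw [hζ, norm_mul, Complex.norm_real, Real.norm_of_nonneg ht.1]
          exact mul_le_of_le_one_left (norm_nonneg _) ht.2
        exact (mul_le_of_le_one_left (norm_nonneg _) z.norm_lt_one.le).trans
          (hsmall ζ (hζz.trans hz))
    simpa using this
  have hderiv : ∀ z, vLog z * ‖discDeriv (S h).fn z‖ ≤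
      20 * m * ‖g‖ + (C₁ + C₂) * (ε * ‖g‖) := fun z => by
    have hv := (vLog.pos z).le
    have hA := vLog_mul_second_deriv_le hφ hS z
    have hB := vLog_mul_deriv_sq_le hφ hS z
    rw [discDeriv_weightedCompOp_bloch hφ hS]
    set A := discDeriv (discDeriv fun z => (φ z : ℂ)) z
    set B := discDeriv (fun z => (φ z : ℂ)) z ^ 2
    have hsplit : vLog z * ‖A * h.fn (φ z) + B * discDeriv h.fn (φ z)‖ ≤
        vLog z * ‖A‖ * ‖h.fn (φ z)‖ + vLog z * ‖B‖ * ‖discDeriv h.fn (φ z)‖ := by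
      rw [mul_assoc, mul_assoc, ← mul_add, ← norm_mul, ← norm_mul]
      exact mul_le_mul_of_nonneg_left (norm_add_le _ _) hv
    refine hsplit.trans ?_
    rcases le_or_gt ‖(φ z : ℂ)‖ ρ with hz | hz
    · have hz' : ‖(φ z : ℂ)‖ ≤ max ρ ‖(φ 0 : ℂ)‖ := hz.trans (le_max_left _ _)
      calc _ ≤ C₁ * (ε * ‖g‖) + C₂ * (ε * ‖g‖) := by
            gcongr
            · exact hval _ hz'
            · exact hsmall _ hz'
        _ = (C₁ + C₂) * (ε * ‖g‖) := by ring
        _ ≤ _ := le_add_of_nonneg_left (by positivity)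
    · have hw := wLog.pos (φ z)
      have hvφ := vLog.pos (φ z)
      have hgrow := norm_le_div_wLog h.isHolo h0 hM (φ z)
      have hM' := hM (φ z)
      calc _ ≤ m * wLog (φ z) * (3 * (5 * ‖g‖) / wLog (φ z)) +
            m * vLog (φ z) * ‖discDeriv h.fn (φ z)‖ := by
            refine add_le_add (mul_le_mul (h₁ z hz) hgrow (norm_nonneg _) (by positivity)) ?_
            exact mul_le_mul_of_nonneg_right (h₂ z hz) (norm_nonneg _)
        _ = 15 * m * ‖g‖ + m * (vLog (φ z) * ‖discDeriv h.fn (φ z)‖) := by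
            field_simp
            ring
        _ ≤ 15 * m * ‖g‖ + m * (5 * ‖g‖) := by gcongr
        _ = 20 * m * ‖g‖ := by ring
        _ ≤ _ := le_add_of_nonneg_right (by positivity)
  have hzero : ‖(S h).fn 0‖ ≤ C₀ * (ε * ‖g‖) := by
    rw [hS, weightedCompOp, norm_mul]
    gcongr
    exact hval _ (le_max_right _ _)
  calc ‖S h‖ ≤ C₀ * (ε * ‖g‖) + (20 * m * ‖g‖ + (C₁ + C₂) * (ε * ‖g‖)) :=
        (Bloch.norm_le hderiv).trans (by gcongr)
    _ ≤ 20 * m * ‖g‖ + ε * (C₀ + C₁ + C₂ + 1) * ‖g‖ := by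
        have : 0 ≤ ε * ‖g‖ := by positivity
        linarith
    _ = (20 * m + η) * ‖g‖ := by rw [hεC]; ring

lemma essNorm_le_powerQuantity :
    ENNReal.ofReal (essNorm S) ≤ 1600 * powerQuantity φ := by
  rcases eq_or_ne (powerQuantity φ) ∞ with htop | htop
  · simp [htop]
  refine ENNReal.le_of_forall_pos_le_add fun ε hε _ => ?_
  set q := (powerQuantity φ).toReal with hq
  have hq0 : 0 ≤ q := ENNReal.toReal_nonneg
  have hqe : powerQuantity φ = ENNReal.ofReal q := (ENNReal.ofReal_toReal htop).symm
  have hε0 : (0 : ℝ) < ε := NNReal.coe_pos.2 hε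
  set m : ℝ := q + ε / 1600 with hm
  have hm0 : 0 ≤ m := by positivity
  have hlt : powerQuantity φ < ENNReal.ofReal m := by
    rw [hqe]
    exact (ENNReal.ofReal_lt_ofReal_iff (by positivity)).2 (by rw [hm]; linarith)
  rw [powerQuantity_eq hφ, max_lt_iff] at hlt
  obtain ⟨ρ₁, hρ₁, h₁⟩ := exists_le_of_limsup_growthENorm_div_lt (fun N => by
    obtain ⟨ρ, hρ, h⟩ := exists_pow_almost_extremal N
    exact ⟨ρ, hρ, fun z hz => (h z hz).imp fun n hn => ⟨hn.1, fun s => (hn.2 s).2⟩⟩) hm0 hlt.1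
  obtain ⟨ρ₂, hρ₂, h₂⟩ := exists_le_of_limsup_growthENorm_div_lt (fun N => by
    obtain ⟨ρ, hρ, h⟩ := exists_pow_almost_extremal N
    exact ⟨ρ, hρ, fun z hz => (h z hz).imp fun n hn => ⟨hn.1, fun s => (hn.2 s).1⟩⟩) hm0 hlt.2
  have h := essNorm_le_of_near_boundary hφ hS (m := 80 * m) (by positivity) (max_lt hρ₁ hρ₂)
    (fun z hz => h₁ z ((le_max_left _ _).trans_lt hz))
    fun z hz => h₂ z ((le_max_right _ _).trans_lt hz)
  have h' : essNorm S ≤ 1600 * q + ε := by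
    rw [hm] at h
    linarith
  refine (ENNReal.ofReal_le_ofReal h').trans_eq ?_
  rw [ENNReal.ofReal_add (by positivity) ε.coe_nonneg, ENNReal.ofReal_mul (by norm_num),
    ENNReal.ofReal_coe_nnreal, ← hqe]
  norm_num

end Main

end DiscSpaces

end

theorem mainTheorem5 :
    ∃ K : ℝ≥0, 0 < K ∧
      ∀ φ : 𝔻 → 𝔻, IsHolo (fun z => (φ z : ℂ)) →
        ∀ T : Zygmund vLog →L[ℂ] Zygmund vLog,
          (∀ f : Zygmund vLog, (T f).fn = compOp φ f.fn) →
            (∃ S : Bloch vLog →L[ℂ] Bloch vLog,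
              (∀ f : Bloch vLog,
                (S f).fn = weightedCompOp (discDeriv (fun z => (φ z : ℂ))) φ f.fn) ∧
              essNorm T = essNorm S) ∧
            (K : ℝ≥0∞)⁻¹ * ENNReal.ofReal (essNorm T) ≤ powerQuantity φ ∧
            powerQuantity φ ≤ (K : ℝ≥0∞) * ENNReal.ofReal (essNorm T) := by
  refine ⟨4800000, by norm_num, fun φ hφ T hT => ?_⟩
  obtain ⟨S, hS, hTS⟩ := exists_weightedCompOp_essNorm_eq hφ T hT
  have hK : ((4800000 : ℝ≥0) : ℝ≥0∞) = 4800000 := by norm_num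
  rw [hK, hTS]
  refine ⟨⟨S, hS, rfl⟩, ?_, powerQuantity_le hφ hS⟩
  rw [← ENNReal.div_eq_inv_mul]
  refine ENNReal.div_le_of_le_mul' ((essNorm_le_powerQuantity hφ hS).trans ?_)
  gcongr
  norm_num
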